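/- Let $n\ge 1$, $\mathbb X=\mathbb R^n$, $\mathbb U=\mathbb R^m$. Let $k:\mathbb X\times\mathbb X\to\mathbb R$ be a reproducing kernel with $\sup_x k(x,x)<\infty$, with reproducing kernel Hilbert space $\mathcal K$, and let $\boldsymbol{\mathcal K}=\mathcal K^m$ be the space with operator-valued kernel $\mathfrak K=k I_m$; write $E_xf=f(x)$. For a finite set of centers $\Xi_N=\{\xi_1,\dots,\xi_N\}$ let $\boldsymbol\Pi_N$ be the orthogonal projection of $\boldsymbol{\mathcal K}$ onto $\boldsymbol{\mathcal K}_N=\mathrm{span}\{\mathfrak K_{\xi_i}y: 1\le i\le N,\ y\in\mathbb U\}$, and let $\mathcal P_N(x)=\sqrt{k(x,x)-k_N(x,x)}$ be the power function of $\mathcal K_N=\mathrm{span}\{k_{\xi_i}\}$, where $k_N$ is the reproducing kernel of $\mathcal K_N\subseteq\mathcal K$. The fill distance is $h_{\Xi_N,\Omega}=\sup_{x\in\Omega}\min_i\|x-\xi_i\|$ and the separation radius is $r_{\Xi_N}=\frac12\min_{i\ne j}\|\xi_i-\xi_j\|$; the centers are quasiuniform with constant $q\ge1$ if $r_{\Xi_N}\le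 h_{\Xi_N,\Omega}\le q\,r_{\Xi_N}$ (no condition if $N=1$). *Control system.* Plant $\dot x=Ax+B\Lambda(\mu+\Theta^T\Phi(x)+f(x))$ with $f\in\boldsymbol{\mathcal K}$ and $\Phi:\mathbb R^n\to\mathbb R^p$ continuous; reference $\dot x_r=A_{ref}x_r+B_{ref}r$ with $r$ bounded and $\|x_r(t)\|\le\bar x_r$; matching conditions $A_{ref}=A+B\Lambda K_x^T$, $B_{ref}=B\Lambda K_r^T$; $P,Q$ symmetric positive definite with $A_{ref}^TP+PA_{ref}=-Q$; $\Lambda,\Gamma_x,\Gamma_r,\Gamma_\Theta,\Gamma_f$ symmetric positive definite, $\Gamma_f\Lambda=\Lambda\Gamma_f$. With $e=x-x_r$ the feedback is $\mu=\hat K_x^Tx+\hat K_r^Tr-\hat\Theta^T\Phi(x)-E_x\hat f_N$, $\hat f_N(t)\in\boldsymbol{\mathcal K}_N$, with learning laws $$\dot{\hat K}_x=-\sigma'(e^TPe)\Gamma_x x e^TPB,\quad \dot{\hat K}_r=-\sigma'(e^TPe)\Gamma_r r e^TPB,$$ $$\dot{\hat\Theta}=\sigma'(e^TPe)\Gamma_\Theta\Phi(x)e^TPB,\quad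 \dot{\hat f}_N=\sigma'(e^TPe)\Gamma_f\boldsymbol\Pi_N\mathfrak K_{x}B^TPe .$$ Here $\sigma:[0,\infty)\to[0,\infty)$ is a smoothed deadzone of tracking radius $\Delta>0$: with $D=\lambda_{\min}(P)\Delta^2$, $\sigma$ is $C^1$, $\sigma=\sigma'=0$ on $[0,D]$, $\sigma'>0$ on $(D,\infty)$, and $\sigma'$ is locally Lipschitz. Trajectories are solutions on $[0,\infty)$. With $\tilde K_x=K_x-\hat K_x$, etc., the initial data satisfy $\mathrm{tr}(\tilde K_x(0)^T\Gamma_x^{-1}\tilde K_x(0)\Lambda)<C_x$, the analogous bounds with $C_r,C_\Theta$, $(\tilde f(0),\Gamma_f^{-1}\Lambda\tilde f(0))_{\boldsymbol{\mathcal K}}<C_f$, and $R>0$ satisfies $\sigma(e(0)^TPe(0))+C_x+C_r+C_\Theta+C_f<\sigma(\lambda_{\min}(P)R^2)$. Put $\bar R=\bar x_r+R$, $\Omega=\overline{B_{\bar R}(0)}$, $$\kappa=\frac{2\|PB\Lambda\|}{\lambda_{\min}(Q)}\sqrt{\frac{\lambda_{\max}(P)}{\lambda_{\min}(P)}},\qquad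 \bar\Delta_N(f)=\kappa\sup_{\xi\in\Omega}\|E_\xi(I-\boldsymbol\Pi_N)f\|_{\mathbb U}.$$ *Statement.* Let $s\ge1$ be an integer, $C,\rho,\delta>0$, and let $\Xi_N\subset\Omega$ be a nonempty set of $N$ centers, quasiuniform with constant $q$, such that $\mathcal P_N(x)\le C h_{\Xi_N,\Omega}^s$ for all $x\in\Omega$. Put $C_*=(1+\delta)\kappa C\rho$. Then: 1. $(1+\delta)\bar\Delta_N(f)\le C_*h^s_{\Xi_N,\Omega}$ for all $f\in\boldsymbol{\mathcal K}$ with $\|f\|_{\boldsymbol{\mathcal K}}\le\rho$. 2. For every $f\in\boldsymbol{\mathcal K}$ and every $\Delta>\bar\Delta_N(f)$, every closed-loop trajectory as above with deadzone radius $\Delta$ satisfies $\limsup_{t\to\infty}\|x(t)-x_r(t)\|\le\Delta$. 3. If $\varepsilon>0$ and the performance bound meets the target, $C_*h^s_{\Xi_N,\Omega}\le\varepsilon$, then for all $f$ with $\|f\|_{\boldsymbol{\mathcal K}}\le\rho$ and all deadzone radii $\bar\Delta_N(f)<\Delta\le C_*h^s_{\Xi_N,\Omega}$ every such trajectory satisfies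 $\limsup_{t\to\infty}\|x(t)-x_r(t)\|\le\varepsilon$, and the number of centers necessarily satisfies $$N\ \ge\ \bar R^{\,n}\,C_*^{\,n/s}\ \frac1{\varepsilon^{n/s}} .$$ 4. Conversely, if $\varepsilon>0$ and $\varepsilon\le C_*h^s_{\Xi_N,\Omega}$, then $N\le(2q\bar R)^n\,C_*^{\,n/s}\,\varepsilon^{-n/s}$. -/

import Mathlib

open Filter Metric Set RKHS
open scoped Topology ENNReal

noncomputable section

/-! ### Point sets -/

/-- Fill distance `h_{Ξ,Ω} = sup_{ω ∈ Ω} min_{ξ ∈ Ξ} d(ω, ξ)`. -/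
def fillDistance {X : Type*} [PseudoMetricSpace X] (Ξ Ω : Set X) : ℝ :=
  ⨆ ω : Ω, infDist (ω : X) Ξ

/-- Separation radius: half of the smallest distance between two distinct centers. -/
def separationRadius {X : Type*} [PseudoMetricSpace X] (Ξ : Set X) : ℝ :=
  Ξ.infsep / 2

/-- `Ξ` is quasiuniform in `Ω` with constant `q`: `r_Ξ ≤ h_{Ξ,Ω} ≤ q r_Ξ`.
A single point has no separation radius, so the condition is void for it. -/
def IsQuasiuniform {X : Type*} [PseudoMetricSpace X] (q : ℝ) (Ξ Ω : Set X) : Prop :=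
  Ξ.Nontrivial →
    separationRadius Ξ ≤ fillDistance Ξ Ω ∧ fillDistance Ξ Ω ≤ q * separationRadius Ξ

/-! ### Subspaces generated by centers, projections, power functions -/

section Kernel

variable {X V : Type*} [NormedAddCommGroup V] [InnerProductSpace ℝ V]
  [CompleteSpace V] (K : Type*) [NormedAddCommGroup K] [InnerProductSpace ℝ K] [CompleteSpace K]
  [RKHS ℝ K X V]

/-- The space `span {𝔎_ξ y | ξ ∈ Ξ, y ∈ V}` generated by the centers. -/
def centerSpace (Ξ : Finset X) : Submodule ℝ K :=
  Submodule.span ℝ {g | ∃ ξ ∈ Ξ, ∃ y : V, g = kerFun K ξ y}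

instance centerSpace_finiteDimensional [FiniteDimensional ℝ V] (Ξ : Finset X) :
    FiniteDimensional ℝ (centerSpace K Ξ) := by
  have h : centerSpace K Ξ ≤ Ξ.sup fun ξ => LinearMap.range (kerFun K ξ).toLinearMap := by
    refine Submodule.span_le.2 ?_
    rintro g ⟨ξ, hξ, y, rfl⟩
    exact (Finset.le_sup (f := fun ξ => LinearMap.range (kerFun K ξ).toLinearMap) hξ) ⟨y, rfl⟩
  have := Submodule.finiteDimensional_finset_sup Ξ
    (fun ξ => LinearMap.range (kerFun K ξ).toLinearMap)
  exact Submodule.finiteDimensional_of_le h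

/-- The orthogonal projection `Π_N` of `K` onto the space generated by the centers. -/
def centerProj [FiniteDimensional ℝ V] (Ξ : Finset X) : K →L[ℝ] K :=
  (centerSpace K Ξ).starProjection

/-- The kernel `𝔎_N(x, x') = E_x Π_N E_{x'}^*` of the space generated by the centers. -/
def centerKernel [FiniteDimensional ℝ V] (Ξ : Finset X) (x x' : X) : V →L[ℝ] V :=
  (kerFun K x).adjoint ∘L centerProj K Ξ ∘L kerFun K x'

/-- The power function `√‖𝔎(x, x) - 𝔎_N(x, x)‖`. -/
def powerFunction [FiniteDimensional ℝ V] (Ξ : Finset X) (x : X) : ℝ :=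
  √‖kernel K x x - centerKernel K Ξ x x‖

end Kernel

/-! ### The space `𝒦^m`, with operator-valued kernel `k I_m` -/

section Power

variable {X : Type*} (H : Type*) [NormedAddCommGroup H] [InnerProductSpace ℝ H]
  [RKHS ℝ H X ℝ]

/-- The Hilbert space `𝒦^m`. -/
abbrev PowerRKHS (m : ℕ) (H : Type*) : Type _ := PiLp 2 (fun _ : Fin m => H)

/-- Elements of `𝒦^m` are the functions `x ↦ (f₁ x, …, f_m x)`. -/
instance instPowerRKHS (m : ℕ) : RKHS ℝ (PowerRKHS m H) X (EuclideanSpace ℝ (Fin m)) where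
  coeCLM := ContinuousLinearMap.pi fun x =>
    (EuclideanSpace.equiv (Fin m) ℝ).symm.toContinuousLinearMap ∘L
      ContinuousLinearMap.pi fun j =>
        (ContinuousLinearMap.proj x ∘L RKHS.coeCLM (H := H) ℝ) ∘L PiLp.proj 2 (fun _ : Fin m => H) j
  coeCLM_injective := by
    intro f g hfg
    refine PiLp.ext fun j => RKHS.ext fun x => ?_
    exact congrArg (fun v : EuclideanSpace ℝ (Fin m) => v j) (congrFun hfg x)

/-- The evaluation `E_x f = f(x) = (f₁ x, …, f_m x)`. -/
def evalAt {H} [NormedAddCommGroup H] [InnerProductSpace ℝ H] [RKHS ℝ H X ℝ] {m : ℕ} (x : X)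
    (f : PowerRKHS m H) : EuclideanSpace ℝ (Fin m) :=
  WithLp.toLp 2 fun j => (f j : H) x

lemma coeCLM_powerRKHS (m : ℕ) (f : PowerRKHS m H) (x : X) : coeCLM ℝ f x = evalAt x f := rfl

variable [CompleteSpace H]

lemma powerRKHS_kerFun (m : ℕ) (x : X) (y : EuclideanSpace ℝ (Fin m)) (j : Fin m) :
    (kerFun (PowerRKHS m H) x y) j = kerFun H x (y j) := by
  have : kerFun (PowerRKHS m H) x y = WithLp.toLp 2 fun j => kerFun H x (y j) := by
    refine ext_inner_right ℝ fun g => ?_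
    rw [kerFun_inner, PiLp.inner_apply, PiLp.inner_apply]
    refine Finset.sum_congr rfl fun j _ => ?_
    rw [kerFun_inner]
    rfl
  rw [this]

/-- The operator-valued kernel of `𝒦^m` is `k I_m`. -/
lemma powerRKHS_kernel (m : ℕ) (x x' : X) :
    kernel (PowerRKHS m H) x x' =
      (kernel H x x' 1) • ContinuousLinearMap.id ℝ (EuclideanSpace ℝ (Fin m)) := by
  ext y j
  rw [← kerFun_apply]
  change (kerFun (PowerRKHS m H) x' y j : H) x = _
  rw [powerRKHS_kerFun, kerFun_apply]
  have h : y j = (y j) • (1 : ℝ) := by simp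
  rw [h, map_smul]
  simp [mul_comm]

end Power

/-- A matrix acting on `𝒦^m` through the values: `(M f)(x) = M f(x)`. -/
def matAct {m : ℕ} {H : Type*} [AddCommGroup H] [Module ℝ H]
    (M : Matrix (Fin m) (Fin m) ℝ) (f : PowerRKHS m H) : PowerRKHS m H :=
  WithLp.toLp 2 fun i => ∑ j, M i j • f j

/-! ### Matrices -/

/-- Smallest eigenvalue of a real symmetric matrix. -/
def lamMin {n : ℕ} (M : Matrix (Fin n) (Fin n) ℝ) : ℝ := sInf (spectrum ℝ M)

/-- Largest eigenvalue of a real symmetric matrix. -/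
def lamMax {n : ℕ} (M : Matrix (Fin n) (Fin n) ℝ) : ℝ := sSup (spectrum ℝ M)

open scoped Matrix.Norms.L2Operator in
/-- Spectral norm: the operator norm for the Euclidean norms. -/
def opNorm {a b : ℕ} (M : Matrix (Fin a) (Fin b) ℝ) : ℝ := ‖M‖

/-- Matrix times Euclidean vector. -/
def mv {a b : ℕ} (M : Matrix (Fin a) (Fin b) ℝ) (v : EuclideanSpace ℝ (Fin b)) :
    EuclideanSpace ℝ (Fin a) :=
  WithLp.toLp 2 (M.mulVec v.ofLp)

/-- The matrix `v wᵀ`. -/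
def outer {a b : ℕ} (v : EuclideanSpace ℝ (Fin a)) (w : EuclideanSpace ℝ (Fin b)) :
    Matrix (Fin a) (Fin b) ℝ :=
  Matrix.vecMulVec v.ofLp w.ofLp

/-- The quadratic form `eᵀ P e`. -/
def quadForm {n : ℕ} (P : Matrix (Fin n) (Fin n) ℝ) (e : EuclideanSpace ℝ (Fin n)) : ℝ :=
  inner ℝ e (mv P e)

/-- The weighted square `tr (Mᵀ Γ⁻¹ M Λ)`. -/
def weightedSq {a m : ℕ} (Γ : Matrix (Fin a) (Fin a) ℝ) (Λ : Matrix (Fin m) (Fin m) ℝ)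
    (M : Matrix (Fin a) (Fin m) ℝ) : ℝ :=
  (M.transpose * Γ⁻¹ * M * Λ).trace

/-! ### Smoothed deadzones -/

/-- A smoothed deadzone function `σ : [0, ∞) → ℝ` that vanishes on `[0, D]`. The derivative is
positive beyond `D`, so that adaptation is active outside the deadzone. -/
structure IsDeadzone (D : ℝ) (σ : ℝ → ℝ) : Prop where
  size_pos : 0 < D
  contDiff : ContDiffOn ℝ 1 σ (Ici 0)
  nonneg : ∀ y, 0 ≤ y → 0 ≤ σ y
  eq_zero : ∀ y ∈ Icc 0 D, σ y = 0
  deriv_nonneg : ∀ y, 0 ≤ y → 0 ≤ derivWithin σ (Ici 0) y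
  deriv_eq_zero : ∀ y ∈ Icc 0 D, derivWithin σ (Ici 0) y = 0
  deriv_pos : ∀ y, D < y → 0 < derivWithin σ (Ici 0) y
  deriv_lipschitz : LocallyLipschitzOn (Ici 0) (derivWithin σ (Ici 0))

/-! ### Model reference adaptive control -/

/-- Plant `ẋ = A x + B Λ (μ + Θᵀ Φ(x) + f(x))`, reference model `ẋ_r = A_ref x_r + B_ref r`, ideal
gains `K_x, K_r`, Lyapunov matrices `P, Q` and adaptation gains `Γ`. -/
structure MRACData (n m p : ℕ) where
  A : Matrix (Fin n) (Fin n) ℝ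
  B : Matrix (Fin n) (Fin m) ℝ
  Λ : Matrix (Fin m) (Fin m) ℝ
  Θ : Matrix (Fin p) (Fin m) ℝ
  Φ : EuclideanSpace ℝ (Fin n) → EuclideanSpace ℝ (Fin p)
  Aref : Matrix (Fin n) (Fin n) ℝ
  Bref : Matrix (Fin n) (Fin m) ℝ
  Kx : Matrix (Fin n) (Fin m) ℝ
  Kr : Matrix (Fin m) (Fin m) ℝ
  P : Matrix (Fin n) (Fin n) ℝ
  Q : Matrix (Fin n) (Fin n) ℝ
  Γx : Matrix (Fin n) (Fin n) ℝ
  Γr : Matrix (Fin m) (Fin m) ℝ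
  ΓΘ : Matrix (Fin p) (Fin p) ℝ
  Γf : Matrix (Fin m) (Fin m) ℝ

/-- Standing assumptions: the weights are symmetric positive definite, `P` solves the Lyapunov
equation of the reference model (so `A_ref` is Hurwitz), and the matching conditions hold. -/
structure MRACData.IsAdmissible {n m p : ℕ} (S : MRACData n m p) : Prop where
  Φ_continuous : Continuous S.Φ
  Λ_posDef : S.Λ.PosDef
  P_posDef : S.P.PosDef
  Q_posDef : S.Q.PosDef
  Γx_posDef : S.Γx.PosDef
  Γr_posDef : S.Γr.PosDef
  ΓΘ_posDef : S.ΓΘ.PosDef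
  Γf_posDef : S.Γf.PosDef
  Γf_comm : Commute S.Γf S.Λ
  lyapunov : S.Aref.transpose * S.P + S.P * S.Aref = -S.Q
  match_A : S.Aref = S.A + S.B * S.Λ * S.Kx.transpose
  match_B : S.Bref = S.B * S.Λ * S.Kr.transpose

/-- The closed-loop signals: state, estimates of the gains and of the parametric uncertainty, and
estimate of the functional uncertainty. -/
structure LoopSignals (n m p : ℕ) (H : Type*) where
  x : ℝ → EuclideanSpace ℝ (Fin n)
  Kx : ℝ → Matrix (Fin n) (Fin m) ℝ
  Kr : ℝ → Matrix (Fin m) (Fin m) ℝ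
  Θ : ℝ → Matrix (Fin p) (Fin m) ℝ
  f : ℝ → PowerRKHS m H

section Loop

variable {n m p : ℕ} {H : Type*} [NormedAddCommGroup H] [InnerProductSpace ℝ H] [CompleteSpace H]
  [RKHS ℝ H (EuclideanSpace ℝ (Fin n)) ℝ]

/-- The feedback `μ = K̂_xᵀ x + K̂_rᵀ r - Θ̂ᵀ Φ(x) - f̂_N(x)`. -/
def MRACData.control (S : MRACData n m p) (Z : LoopSignals n m p H)
    (r : ℝ → EuclideanSpace ℝ (Fin m)) (t : ℝ) : EuclideanSpace ℝ (Fin m) :=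
  mv (Z.Kx t).transpose (Z.x t) + mv (Z.Kr t).transpose (r t)
    - mv (Z.Θ t).transpose (S.Φ (Z.x t)) - evalAt (Z.x t) (Z.f t)

/-- `xr` is a trajectory of the reference model on `[0, ∞)` driven by `r`. -/
def MRACData.IsReference (S : MRACData n m p) (r : ℝ → EuclideanSpace ℝ (Fin m))
    (xr : ℝ → EuclideanSpace ℝ (Fin n)) : Prop :=
  ∀ t, 0 ≤ t → HasDerivWithinAt xr (mv S.Aref (xr t) + mv S.Bref (r t)) (Ici 0) t

/-- `Z` solves on `[0, ∞)` the closed loop of plant, feedback and smoothed deadzone learning laws,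
with functional uncertainty `f` and centers `Ξ`. -/
structure MRACData.IsClosedLoop (S : MRACData n m p) (Ξ : Finset (EuclideanSpace ℝ (Fin n)))
    (f : PowerRKHS m H) (σ : ℝ → ℝ) (r : ℝ → EuclideanSpace ℝ (Fin m))
    (xr : ℝ → EuclideanSpace ℝ (Fin n)) (Z : LoopSignals n m p H) : Prop where
  state : ∀ t, 0 ≤ t → HasDerivWithinAt Z.x
    (mv S.A (Z.x t) + mv (S.B * S.Λ)
      (S.control Z r t + mv S.Θ.transpose (S.Φ (Z.x t)) + evalAt (Z.x t) f)) (Ici 0) t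
  law_Kx : ∀ t, 0 ≤ t → ∀ i j, HasDerivWithinAt (fun τ => Z.Kx τ i j)
    (-derivWithin σ (Ici 0) (quadForm S.P (Z.x t - xr t)) *
      (S.Γx * outer (Z.x t) (Z.x t - xr t) * S.P * S.B) i j) (Ici 0) t
  law_Kr : ∀ t, 0 ≤ t → ∀ i j, HasDerivWithinAt (fun τ => Z.Kr τ i j)
    (-derivWithin σ (Ici 0) (quadForm S.P (Z.x t - xr t)) *
      (S.Γr * outer (r t) (Z.x t - xr t) * S.P * S.B) i j) (Ici 0) t
  law_Θ : ∀ t, 0 ≤ t → ∀ i j, HasDerivWithinAt (fun τ => Z.Θ τ i j)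
    (derivWithin σ (Ici 0) (quadForm S.P (Z.x t - xr t)) *
      (S.ΓΘ * outer (S.Φ (Z.x t)) (Z.x t - xr t) * S.P * S.B) i j) (Ici 0) t
  mem_f : ∀ t, 0 ≤ t → Z.f t ∈ centerSpace (PowerRKHS m H) Ξ
  law_f : ∀ t, 0 ≤ t → HasDerivWithinAt Z.f
    (derivWithin σ (Ici 0) (quadForm S.P (Z.x t - xr t)) •
      matAct S.Γf (centerProj (PowerRKHS m H) Ξ
        (kerFun (PowerRKHS m H) (Z.x t) (mv (S.B.transpose * S.P) (Z.x t - xr t))))) (Ici 0) t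

/-- The initial estimation errors lie in the uncertainty classes of sizes `Cx, Cr, CΘ, Cf`, and the
radius `R` is so large that the Lyapunov function starts below its values at tracking error `R`. -/
structure MRACData.InitialBound (S : MRACData n m p) (f : PowerRKHS m H) (σ : ℝ → ℝ)
    (xr : ℝ → EuclideanSpace ℝ (Fin n)) (Z : LoopSignals n m p H) (Cx Cr CΘ Cf R : ℝ) : Prop where
  class_Kx : weightedSq S.Γx S.Λ (S.Kx - Z.Kx 0) < Cx
  class_Kr : weightedSq S.Γr S.Λ (S.Kr - Z.Kr 0) < Cr
  class_Θ : weightedSq S.ΓΘ S.Λ (S.Θ - Z.Θ 0) < CΘ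
  class_f : inner ℝ (f - Z.f 0) (matAct (S.Γf⁻¹ * S.Λ) (f - Z.f 0)) < Cf
  radius : σ (quadForm S.P (Z.x 0 - xr 0)) + Cx + Cr + CΘ + Cf < σ (lamMin S.P * R ^ 2)

/-- For the uncertainty `f`, the centers `Ξ` and any smoothed deadzone acting on `eᵀ P e ≤
λ_min(P) Δ²`, every closed-loop trajectory tracking a reference bounded by `xrbar`, with initial
data of size `R`, satisfies `limsup ‖x(t) - x_r(t)‖ ≤ b`. -/
def MRACData.UltimateBound (S : MRACData n m p) (Ξ : Finset (EuclideanSpace ℝ (Fin n)))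
    (f : PowerRKHS m H) (xrbar R Δ b : ℝ) : Prop :=
  ∀ (σ : ℝ → ℝ), IsDeadzone (lamMin S.P * Δ ^ 2) σ →
  ∀ (r : ℝ → EuclideanSpace ℝ (Fin m)) (xr : ℝ → EuclideanSpace ℝ (Fin n))
    (Z : LoopSignals n m p H) (Cx Cr CΘ Cf : ℝ),
    (∃ rbar : ℝ, ∀ t, 0 ≤ t → ‖r t‖ ≤ rbar) → (∀ t, 0 ≤ t → ‖xr t‖ ≤ xrbar) →
    S.IsReference r xr → S.IsClosedLoop Ξ f σ r xr Z →
    S.InitialBound f σ xr Z Cx Cr CΘ Cf R →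
    limsup (fun t => ‖Z.x t - xr t‖ₑ) atTop ≤ ENNReal.ofReal b

/-- The factor `2 ‖P B Λ‖ / λ_min(Q) · √(λ_max(P) / λ_min(P))`. -/
def MRACData.gain (S : MRACData n m p) : ℝ :=
  2 * opNorm (S.P * S.B * S.Λ) / lamMin S.Q * √(lamMax S.P / lamMin S.P)

/-- The deadzone threshold: the gain times `sup_{‖ξ‖ ≤ Rbar} ‖E_ξ (I - Π_N) f‖`. -/
def MRACData.threshold (S : MRACData n m p) (Rbar : ℝ) (Ξ : Finset (EuclideanSpace ℝ (Fin n)))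
    (f : PowerRKHS m H) : ℝ :=
  S.gain * ⨆ ξ : closedBall (0 : EuclideanSpace ℝ (Fin n)) Rbar,
    ‖evalAt (ξ : EuclideanSpace ℝ (Fin n)) (f - centerProj (PowerRKHS m H) Ξ f)‖

/-- The performance bound `(1 + δ) · gain · C ρ · h_{Ξ,Ω}^s` on the ball `Ω` of radius `Rbar`, for
power functions bounded by `C h^s` and uncertainties of norm at most `ρ`. -/
def MRACData.performanceBound (S : MRACData n m p) (δ C ρ Rbar : ℝ) (s : ℕ)
    (Ξ : Finset (EuclideanSpace ℝ (Fin n))) : ℝ :=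
  (1 + δ) * S.gain * C * ρ * fillDistance (Ξ : Set (EuclideanSpace ℝ (Fin n)))
    (closedBall 0 Rbar) ^ s

end Loop

end

/-! ### Quadratic forms of symmetric matrices -/

section Matrices

variable {a b c : ℕ}

/-! The tracking bound is a Lyapunov argument with a deadzone. Write `e = x - x_r`, `y = eᵀPe`, `D =
λ_min(P)Δ²`, and let `V` be `σ(y)` plus the weighted squares of the four estimation errors. Along
the closed loop the learning laws cancel every estimation error in `V'` except the part of `f`
outside the center space: `V' = σ'(y) (-eᵀQe + 2⟨(PBΛ)ᵀe, E_x(I - Π_N)f⟩)`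
(`MRACData.hasDerivWithinAt_lyapunovFun`). If `y > D`, then `‖e‖ ≥ √(λ_min(P)/λ_max(P)) Δ`, and for
`Δ` above the threshold the bracket is at most some `-c < 0` (`MRACData.exists_rate`). Hence `V' ≤
-c σ'(y)`, since `σ'` vanishes in the deadzone.

The residual is controlled only on `Ω`, so the state must first be confined there: `V` starts below
`σ(λ_min(P)R²)` and decreases as long as `y < λ_min(P)R²`, so that level is never reached
(`lt_of_lyapunov`). All signals are then bounded and `y'` is bounded below. A recurrent excursion of
`y` above `D + η` would last a fixed time and cost `V` a fixed amount, which is impossible for `V ≥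
0` (`IsDeadzone.eventually_le`). Thus `limsup y ≤ D`, which gives `limsup ‖e‖ ≤ Δ`.

The threshold is estimated by the reproducing property: the residual at `x` is the pairing of `f`
with `k_x - Π_N k_x`, whose norm is the power function. The count of centers is a comparison of
volumes: balls of radius `h` about the centers cover `Ω`, while balls of radius `r` are disjoint. -/

lemma mv_apply (M : Matrix (Fin a) (Fin b) ℝ) (v : EuclideanSpace ℝ (Fin b)) (i : Fin a) :
    mv M v i = ∑ j, M i j * v j := rfl

lemma mv_add (M : Matrix (Fin a) (Fin b) ℝ) (v w : EuclideanSpace ℝ (Fin b)) :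
    mv M (v + w) = mv M v + mv M w := by
  ext i; simp [mv, Matrix.mulVec_add]

lemma mv_sub (M : Matrix (Fin a) (Fin b) ℝ) (v w : EuclideanSpace ℝ (Fin b)) :
    mv M (v - w) = mv M v - mv M w := by
  ext i; simp [mv, Matrix.mulVec_sub]

lemma add_mv (M N : Matrix (Fin a) (Fin b) ℝ) (v : EuclideanSpace ℝ (Fin b)) :
    mv (M + N) v = mv M v + mv N v := by
  ext i; simp [mv, Matrix.add_mulVec]

lemma sub_mv (M N : Matrix (Fin a) (Fin b) ℝ) (v : EuclideanSpace ℝ (Fin b)) :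
    mv (M - N) v = mv M v - mv N v := by
  ext i; simp [mv, Matrix.sub_mulVec]

lemma mv_mv (M : Matrix (Fin a) (Fin b) ℝ) (N : Matrix (Fin b) (Fin c) ℝ)
    (v : EuclideanSpace ℝ (Fin c)) : mv M (mv N v) = mv (M * N) v := by
  ext i; simp [mv, Matrix.mulVec_mulVec]

lemma inner_eq_dotProduct (v w : EuclideanSpace ℝ (Fin a)) :
    inner ℝ v w = v.ofLp ⬝ᵥ w.ofLp := by
  rw [EuclideanSpace.inner_eq_star_dotProduct, dotProduct_comm]; simp

lemma inner_mv (M : Matrix (Fin a) (Fin b) ℝ) (v : EuclideanSpace ℝ (Fin a))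
    (w : EuclideanSpace ℝ (Fin b)) : inner ℝ v (mv M w) = inner ℝ (mv M.transpose v) w := by
  rw [inner_eq_dotProduct, inner_eq_dotProduct]
  simp [mv, Matrix.dotProduct_mulVec, Matrix.mulVec_transpose]

lemma norm_mv_le (M : Matrix (Fin a) (Fin b) ℝ) (v : EuclideanSpace ℝ (Fin b)) :
    ‖mv M v‖ ≤ opNorm M * ‖v‖ :=
  Matrix.l2_opNorm_mulVec M v

open scoped Matrix.Norms.L2Operator in
lemma opNorm_nonneg (M : Matrix (Fin a) (Fin b) ℝ) : 0 ≤ opNorm M := norm_nonneg M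

open scoped Matrix.Norms.L2Operator in
lemma opNorm_transpose (M : Matrix (Fin a) (Fin b) ℝ) : opNorm M.transpose = opNorm M := by
  rw [← Matrix.conjTranspose_eq_transpose_of_trivial]
  exact Matrix.l2_opNorm_conjTranspose M

lemma quadForm_eq_dotProduct (M : Matrix (Fin a) (Fin a) ℝ) (v : EuclideanSpace ℝ (Fin a)) :
    quadForm M v = v.ofLp ⬝ᵥ M.mulVec v.ofLp :=
  inner_eq_dotProduct _ _

lemma Matrix.PosSemidef.quadForm_nonneg {M : Matrix (Fin a) (Fin a) ℝ} (hM : M.PosSemidef)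
    (v : EuclideanSpace ℝ (Fin a)) : 0 ≤ quadForm M v := by
  rw [quadForm_eq_dotProduct]
  simpa using hM.dotProduct_mulVec_nonneg v.ofLp

lemma quadForm_sub_smul_one (M : Matrix (Fin a) (Fin a) ℝ) (t : ℝ)
    (v : EuclideanSpace ℝ (Fin a)) :
    quadForm (M - t • 1) v = quadForm M v - t * ‖v‖ ^ 2 := by
  rw [quadForm, sub_mv, inner_sub_right, ← quadForm]
  congr 1
  rw [← real_inner_self_eq_norm_sq, ← real_inner_smul_right]
  congr 1
  ext i
  simp [mv, Matrix.smul_mulVec]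

lemma Matrix.IsHermitian.lamMin_le {M : Matrix (Fin a) (Fin a) ℝ} {μ : ℝ}
    (hμ : μ ∈ spectrum ℝ M) : lamMin M ≤ μ :=
  csInf_le (Matrix.finite_real_spectrum (A := M)).bddBelow hμ

lemma Matrix.IsHermitian.le_lamMax {M : Matrix (Fin a) (Fin a) ℝ} {μ : ℝ}
    (hμ : μ ∈ spectrum ℝ M) : μ ≤ lamMax M :=
  le_csSup (Matrix.finite_real_spectrum (A := M)).bddAbove hμ

/-- Subtracting a scalar matrix shifts the spectrum, which then lies in `[0, ∞)`. -/
lemma Matrix.IsHermitian.posSemidef_sub_lamMin {M : Matrix (Fin a) (Fin a) ℝ}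
    (hM : M.IsHermitian) : (M - lamMin M • (1 : Matrix (Fin a) (Fin a) ℝ)).PosSemidef := by
  rw [Matrix.posSemidef_iff_isHermitian_and_spectrum_nonneg]
  refine ⟨hM.sub (by simp [Matrix.IsHermitian]), fun μ hμ => ?_⟩
  rw [← Algebra.algebraMap_eq_smul_one, ← spectrum.sub_singleton_eq] at hμ
  obtain ⟨ν, hν, -, rfl, rfl⟩ := hμ
  simpa using Matrix.IsHermitian.lamMin_le hν

lemma Matrix.IsHermitian.posSemidef_lamMax_sub {M : Matrix (Fin a) (Fin a) ℝ}
    (hM : M.IsHermitian) : (lamMax M • (1 : Matrix (Fin a) (Fin a) ℝ) - M).PosSemidef := by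
  rw [Matrix.posSemidef_iff_isHermitian_and_spectrum_nonneg]
  refine ⟨Matrix.IsHermitian.sub (by simp [Matrix.IsHermitian]) hM, fun μ hμ => ?_⟩
  rw [← Algebra.algebraMap_eq_smul_one, ← spectrum.singleton_sub_eq] at hμ
  obtain ⟨-, rfl, ν, hν, rfl⟩ := hμ
  simpa using Matrix.IsHermitian.le_lamMax hν

lemma Matrix.IsHermitian.lamMin_mul_norm_sq_le {M : Matrix (Fin a) (Fin a) ℝ}
    (hM : M.IsHermitian) (v : EuclideanSpace ℝ (Fin a)) :
    lamMin M * ‖v‖ ^ 2 ≤ quadForm M v := by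
  have := hM.posSemidef_sub_lamMin.quadForm_nonneg v
  rw [quadForm_sub_smul_one] at this
  linarith

lemma Matrix.IsHermitian.quadForm_le_lamMax {M : Matrix (Fin a) (Fin a) ℝ}
    (hM : M.IsHermitian) (v : EuclideanSpace ℝ (Fin a)) :
    quadForm M v ≤ lamMax M * ‖v‖ ^ 2 := by
  have h := hM.posSemidef_lamMax_sub.quadForm_nonneg v
  have h' := quadForm_sub_smul_one M (lamMax M) v
  have : quadForm (lamMax M • (1 : Matrix (Fin a) (Fin a) ℝ) - M) v
      = -quadForm (M - lamMax M • 1) v := by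
    rw [← neg_sub M, quadForm, quadForm, ← inner_neg_right]
    generalize M - lamMax M • 1 = N
    congr 1
    ext i
    simp [mv, Matrix.neg_mulVec]
  linarith

lemma Matrix.PosDef.lamMin_pos [NeZero a] {M : Matrix (Fin a) (Fin a) ℝ} (hM : M.PosDef) :
    0 < lamMin M := by
  have hne : (spectrum ℝ M).Nonempty := by
    rw [hM.1.spectrum_real_eq_range_eigenvalues]; exact range_nonempty _
  have hmem : lamMin M ∈ spectrum ℝ M := hne.csInf_mem Matrix.finite_real_spectrum
  rw [hM.1.spectrum_real_eq_range_eigenvalues] at hmem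
  obtain ⟨i, hi⟩ := hmem
  rw [← hi]
  exact hM.eigenvalues_pos i

lemma Matrix.PosDef.lamMax_pos [NeZero a] {M : Matrix (Fin a) (Fin a) ℝ} (hM : M.PosDef) :
    0 < lamMax M := by
  have hne : (spectrum ℝ M).Nonempty := by
    rw [hM.1.spectrum_real_eq_range_eigenvalues]; exact range_nonempty _
  obtain ⟨μ, hμ⟩ := hne
  exact hM.lamMin_pos.trans_le ((Matrix.IsHermitian.lamMin_le hμ).trans
    (Matrix.IsHermitian.le_lamMax hμ))

lemma Matrix.PosDef.exists_posSemidef_sub {M : Matrix (Fin a) (Fin a) ℝ} (hM : M.PosDef) :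
    ∃ c : ℝ, 0 < c ∧ (M - c • (1 : Matrix (Fin a) (Fin a) ℝ)).PosSemidef := by
  rcases Nat.eq_zero_or_pos a with rfl | ha
  -- In dimension zero the spectrum is empty and `lamMin` is `0`, so it cannot serve as the
  -- constant.
  · exact ⟨1, one_pos, by
      rw [Subsingleton.elim (M - (1 : ℝ) • 1) 0]; exact Matrix.PosSemidef.zero⟩
  · have : NeZero a := ⟨ha.ne'⟩
    exact ⟨lamMin M, hM.lamMin_pos, hM.1.posSemidef_sub_lamMin⟩

open scoped MatrixOrder ComplexOrder in
lemma Matrix.PosSemidef.exists_eq_transpose_mul_self {M : Matrix (Fin a) (Fin a) ℝ}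
    (hM : M.PosSemidef) : ∃ L : Matrix (Fin a) (Fin a) ℝ, M = L.transpose * L := by
  obtain ⟨L, hL⟩ := CStarAlgebra.nonneg_iff_eq_star_mul_self.1 (Matrix.nonneg_iff_posSemidef.2 hM)
  exact ⟨L, by rw [hL, Matrix.star_eq_conjTranspose, Matrix.conjTranspose_eq_transpose_of_trivial]⟩

/-- With `N = LᵀL`, cyclicity turns the trace into that of the positive semidefinite matrix `L M
Lᵀ`. -/
lemma Matrix.PosSemidef.trace_mul_nonneg {M N : Matrix (Fin a) (Fin a) ℝ}
    (hM : M.PosSemidef) (hN : N.PosSemidef) : 0 ≤ (M * N).trace := by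
  obtain ⟨L, rfl⟩ := hN.exists_eq_transpose_mul_self
  rw [← mul_assoc, Matrix.trace_mul_comm, ← mul_assoc]
  have := (hM.mul_mul_conjTranspose_same L).trace_nonneg
  rwa [Matrix.conjTranspose_eq_transpose_of_trivial] at this

open scoped MatrixOrder in
lemma Matrix.PosDef.mul_of_commute {M N : Matrix (Fin a) (Fin a) ℝ}
    (hM : M.PosDef) (hN : N.PosDef) (h : Commute M N) : (M * N).PosDef := by
  have h0 : (M * N).PosSemidef := by
    rw [← Matrix.nonneg_iff_posSemidef]
    exact h.mul_nonneg (Matrix.nonneg_iff_posSemidef.2 hM.posSemidef)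
      (Matrix.nonneg_iff_posSemidef.2 hN.posSemidef)
  exact h0.posDef_iff_isUnit.2 (hM.isUnit.mul hN.isUnit)

end Matrices

/-! ### Covering and packing by centers -/

section Centers

variable {n : ℕ} {ρ : ℝ} {Ξ : Finset (EuclideanSpace ℝ (Fin n))}

lemma infDist_le_fillDistance {X : Type*} [PseudoMetricSpace X] {Ξ Ω : Set X} (hΞ : Ξ.Nonempty)
    (hΩ : Bornology.IsBounded Ω) {x : X} (hx : x ∈ Ω) : infDist x Ξ ≤ fillDistance Ξ Ω := by
  obtain ⟨ξ, hξ⟩ := hΞ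
  obtain ⟨M, hM⟩ := hΩ.subset_closedBall ξ
  refine le_ciSup (f := fun ω : Ω => infDist (ω : X) Ξ) ⟨M, ?_⟩ (⟨x, hx⟩ : Ω)
  rintro _ ⟨ω, rfl⟩
  exact (infDist_le_dist_of_mem hξ).trans (hM ω.2)

lemma fillDistance_nonneg {X : Type*} [PseudoMetricSpace X] (Ξ Ω : Set X) :
    0 ≤ fillDistance Ξ Ω :=
  Real.iSup_nonneg fun _ => infDist_nonneg

lemma fillDistance_closedBall_le (hΞ : Ξ.Nonempty)
    (hsub : (Ξ : Set (EuclideanSpace ℝ (Fin n))) ⊆ closedBall 0 ρ) :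
    fillDistance (Ξ : Set (EuclideanSpace ℝ (Fin n))) (closedBall 0 ρ) ≤ 2 * ρ := by
  obtain ⟨ξ, hξ⟩ := hΞ
  have : Nonempty (closedBall (0 : EuclideanSpace ℝ (Fin n)) ρ) := ⟨⟨ξ, hsub hξ⟩⟩
  refine ciSup_le fun x => (infDist_le_dist_of_mem hξ).trans ?_
  have h1 := mem_closedBall.1 x.2
  have h2 := mem_closedBall'.1 (hsub hξ)
  linarith [dist_triangle (x : EuclideanSpace ℝ (Fin n)) 0 ξ]

open MeasureTheory in
-- Balls of radius `h` about the centers cover `Ω`; compare volumes and cancel that of the unit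
-- ball.
lemma pow_le_card_mul_fillDistance_pow (hρ : 0 ≤ ρ) (hΞ : Ξ.Nonempty) :
    ρ ^ n ≤ Ξ.card * fillDistance (Ξ : Set (EuclideanSpace ℝ (Fin n))) (closedBall 0 ρ) ^ n := by
  set h := fillDistance (Ξ : Set (EuclideanSpace ℝ (Fin n))) (closedBall 0 ρ) with hh
  have h0 : 0 ≤ h := fillDistance_nonneg _ _
  have hcov : closedBall (0 : EuclideanSpace ℝ (Fin n)) ρ ⊆ ⋃ ξ ∈ Ξ, closedBall ξ h := by
    intro x hx
    obtain ⟨ξ, hξ, hd⟩ := Ξ.finite_toSet.isCompact.exists_infDist_eq_dist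
      (Finset.coe_nonempty.2 hΞ) x
    refine mem_biUnion hξ ?_
    rw [mem_closedBall, ← hd]
    exact infDist_le_fillDistance (Finset.coe_nonempty.2 hΞ) isBounded_closedBall hx
  have hv : (volume (ball (0 : EuclideanSpace ℝ (Fin n)) 1)) ≠ 0 :=
    (measure_ball_pos _ _ one_pos).ne'
  have hv' : (volume (ball (0 : EuclideanSpace ℝ (Fin n)) 1)) ≠ ⊤ := measure_ball_lt_top.ne
  have key := (measure_mono (μ := volume) hcov).trans (measure_biUnion_finset_le Ξ _)
  simp_rw [Measure.addHaar_closedBall _ _ h0] at key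
  rw [Measure.addHaar_closedBall _ _ hρ, Finset.sum_const, nsmul_eq_mul, ← mul_assoc,
    ENNReal.mul_le_mul_iff_left hv hv', finrank_euclideanSpace_fin, ← ENNReal.ofReal_natCast,
    ← ENNReal.ofReal_mul (Nat.cast_nonneg _)] at key
  exact (ENNReal.ofReal_le_ofReal_iff (by positivity)).1 key

open MeasureTheory in
-- Balls of the separation radius about the centers are disjoint and lie in the ball enlarged by
-- that radius; compare volumes.
lemma card_mul_separationRadius_pow_le (hρ : 0 ≤ ρ)
    (hsub : (Ξ : Set (EuclideanSpace ℝ (Fin n))) ⊆ closedBall 0 ρ) :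
    Ξ.card * separationRadius (Ξ : Set (EuclideanSpace ℝ (Fin n))) ^ n
      ≤ (ρ + separationRadius (Ξ : Set (EuclideanSpace ℝ (Fin n)))) ^ n := by
  set r := separationRadius (Ξ : Set (EuclideanSpace ℝ (Fin n))) with hr
  have h0 : 0 ≤ r := div_nonneg infsep_nonneg two_pos.le
  have hdisj : (Ξ : Set (EuclideanSpace ℝ (Fin n))).PairwiseDisjoint fun ξ => ball ξ r := by
    intro ξ hξ η hη hne
    refine ball_disjoint_ball ?_
    have := infsep_le_dist_of_mem hξ hη hne
    rw [hr, separationRadius]; linarith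
  have hunion : (⋃ ξ ∈ Ξ, ball ξ r) ⊆ closedBall (0 : EuclideanSpace ℝ (Fin n)) (ρ + r) := by
    refine iUnion₂_subset fun ξ hξ x hx => ?_
    have h1 := mem_closedBall.1 (hsub hξ)
    have h2 := mem_ball.1 hx
    rw [mem_closedBall]
    linarith [dist_triangle x ξ 0]
  have hv : (volume (ball (0 : EuclideanSpace ℝ (Fin n)) 1)) ≠ 0 :=
    (measure_ball_pos _ _ one_pos).ne'
  have hv' : (volume (ball (0 : EuclideanSpace ℝ (Fin n)) 1)) ≠ ⊤ := measure_ball_lt_top.ne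
  have key := measure_mono hunion (μ := volume)
  rw [measure_biUnion_finset hdisj fun _ _ => measurableSet_ball] at key
  -- The radius is `0` for a single center. Then `0 ^ n` vanishes unless `n = 0`, where the space is
  -- one point.
  rcases h0.eq_or_lt with h | h
  · rcases Nat.eq_zero_or_pos n with rfl | hn
    · have : Ξ.card ≤ 1 := Finset.card_le_one.2 fun _ _ _ _ => Subsingleton.elim _ _
      simpa using this
    · rw [← h, zero_pow hn.ne']; simp; positivity
  simp_rw [Measure.addHaar_ball_of_pos _ _ h] at key
  rw [Measure.addHaar_closedBall _ _ (by positivity), Finset.sum_const, nsmul_eq_mul, ← mul_assoc,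
    ENNReal.mul_le_mul_iff_left hv hv', finrank_euclideanSpace_fin, ← ENNReal.ofReal_natCast,
    ← ENNReal.ofReal_mul (Nat.cast_nonneg _)] at key
  exact (ENNReal.ofReal_le_ofReal_iff (by positivity)).1 key

lemma separationRadius_le (hsub : (Ξ : Set (EuclideanSpace ℝ (Fin n))) ⊆ closedBall 0 ρ)
    (hΞ : (Ξ : Set (EuclideanSpace ℝ (Fin n))).Nontrivial) :
    separationRadius (Ξ : Set (EuclideanSpace ℝ (Fin n))) ≤ ρ := by
  obtain ⟨ξ, hξ, η, hη, hne⟩ := hΞ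
  have := infsep_le_dist_of_mem hξ hη hne
  have h1 := mem_closedBall.1 (hsub hξ)
  have h2 := mem_closedBall'.1 (hsub hη)
  rw [separationRadius]
  linarith [dist_triangle ξ 0 η]

/-- Quasiuniformity replaces `h` by `q r` in the packing bound, and `ρ + r ≤ 2ρ`. A lone center has
`h ≤ 2ρ ≤ 2qρ` directly. -/
lemma card_mul_fillDistance_pow_le {q : ℝ} (hq : 1 ≤ q) (hρ : 0 < ρ)
    (hΞ : Ξ.Nonempty) (hsub : (Ξ : Set (EuclideanSpace ℝ (Fin n))) ⊆ closedBall 0 ρ)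
    (hqu : IsQuasiuniform q (Ξ : Set (EuclideanSpace ℝ (Fin n))) (closedBall 0 ρ)) :
    Ξ.card * fillDistance (Ξ : Set (EuclideanSpace ℝ (Fin n))) (closedBall 0 ρ) ^ n
      ≤ (2 * q * ρ) ^ n := by
  have hh := fillDistance_nonneg (Ξ : Set (EuclideanSpace ℝ (Fin n))) (closedBall 0 ρ)
  by_cases hnt : (Ξ : Set (EuclideanSpace ℝ (Fin n))).Nontrivial
  · obtain ⟨-, h2⟩ := hqu hnt
    have hr := separationRadius_le hsub hnt
    have hr0 : 0 ≤ separationRadius (Ξ : Set (EuclideanSpace ℝ (Fin n))) :=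
      div_nonneg infsep_nonneg two_pos.le
    have hp := card_mul_separationRadius_pow_le hρ.le hsub
    set r := separationRadius (Ξ : Set (EuclideanSpace ℝ (Fin n)))
    calc _ ≤ Ξ.card * (q * r) ^ n := by gcongr
      _ = q ^ n * (Ξ.card * r ^ n) := by ring
      _ ≤ q ^ n * (ρ + r) ^ n := by gcongr
      _ ≤ q ^ n * (2 * ρ) ^ n := by gcongr; linarith
      _ = _ := by rw [← mul_pow]; ring_nf
  · have hc : Ξ.card = 1 := by
      have h1 : Ξ.card ≤ 1 := by
        rw [not_nontrivial_iff] at hnt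
        exact Finset.card_le_one.2 fun _ ha _ hb => hnt ha hb
      have := hΞ.card_pos
      omega
    rw [hc, Nat.cast_one, one_mul]
    refine pow_le_pow_left₀ hh ((fillDistance_closedBall_le hΞ hsub).trans ?_) n
    nlinarith

end Centers

/-- `c h ^ s ≤ ε` in terms of `h ^ n`. -/
lemma rpow_div_le_of_mul_pow_le {n s : ℕ} (hs : 1 ≤ s) {c h ε : ℝ} (hc : 0 ≤ c) (hh : 0 ≤ h)
    (hε : 0 < ε) (H : c * h ^ s ≤ ε) :
    h ^ n * (c ^ ((n : ℝ) / s) * (1 / ε ^ ((n : ℝ) / s))) ≤ 1 := by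
  have hs' : (s : ℝ) ≠ 0 := by positivity
  have h1 : h ^ n = (h ^ s) ^ ((n : ℝ) / s) := by
    rw [← Real.rpow_natCast h s, ← Real.rpow_mul hh, mul_div_cancel₀ _ hs', Real.rpow_natCast]
  rw [h1, ← mul_assoc, ← Real.mul_rpow (by positivity) hc, mul_one_div,
    div_le_one (Real.rpow_pos_of_pos hε _), mul_comm]
  exact Real.rpow_le_rpow (by positivity) H (by positivity)

lemma one_le_rpow_div_of_le_mul_pow {n s : ℕ} (hs : 1 ≤ s) {c h ε : ℝ} (hc : 0 ≤ c) (hh : 0 ≤ h)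
    (hε : 0 < ε) (H : ε ≤ c * h ^ s) :
    1 ≤ h ^ n * (c ^ ((n : ℝ) / s) * (1 / ε ^ ((n : ℝ) / s))) := by
  have hs' : (s : ℝ) ≠ 0 := by positivity
  have h1 : h ^ n = (h ^ s) ^ ((n : ℝ) / s) := by
    rw [← Real.rpow_natCast h s, ← Real.rpow_mul hh, mul_div_cancel₀ _ hs', Real.rpow_natCast]
  rw [h1, ← mul_assoc, ← Real.mul_rpow (by positivity) hc, mul_one_div,
    one_le_div (Real.rpow_pos_of_pos hε _), mul_comm]
  exact Real.rpow_le_rpow hε.le H (by positivity)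

/-! ### Projections onto the space generated by the centers -/

section Projection

variable {X : Type*} {H : Type*} [NormedAddCommGroup H] [InnerProductSpace ℝ H]
  [RKHS ℝ H X ℝ] {m : ℕ}

lemma evalAt_apply (x : X) (f : PowerRKHS m H) (j : Fin m) : evalAt x f j = f j x := rfl

lemma evalAt_sub (x : X) (f g : PowerRKHS m H) : evalAt x (f - g) = evalAt x f - evalAt x g := by
  ext j; simp [evalAt_apply, RKHS.coe_sub]

variable [CompleteSpace H]

lemma inner_kerFun_powerRKHS (x : X) (v : EuclideanSpace ℝ (Fin m)) (f : PowerRKHS m H) :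
    inner ℝ (kerFun (PowerRKHS m H) x v) f = inner ℝ v (evalAt x f) := by
  rw [kerFun_inner]; rfl

/-- `Π_N` acts on `𝒦^m` componentwise. -/
lemma centerProj_powerRKHS (Ξ : Finset X) (f : PowerRKHS m H) :
    centerProj (PowerRKHS m H) Ξ f = WithLp.toLp 2 fun j => centerProj H Ξ (f j) := by
  classical
  refine Submodule.eq_starProjection_of_mem_of_inner_eq_zero ?_ ?_
  -- A kernel section of `𝒦` placed in slot `j` is the section of `𝒦^m` in a direction along the
  -- `j`-th axis.
  · have hsingle : ∀ j : Fin m, ∀ g ∈ centerSpace H Ξ,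
        (WithLp.toLp 2 (Pi.single j g) : PowerRKHS m H) ∈ centerSpace (PowerRKHS m H) Ξ := by
      intro j g hg
      induction hg using Submodule.span_induction with
      | mem g hg =>
        obtain ⟨ξ, hξ, y, rfl⟩ := hg
        refine Submodule.subset_span ⟨ξ, hξ, EuclideanSpace.single j y, ?_⟩
        refine PiLp.ext fun i => ?_
        rw [powerRKHS_kerFun]
        by_cases hij : i = j
        · subst hij; simp
        · simp [hij]
      | zero => simp
      | add g g' _ _ hg hg' => simpa [Pi.single_add] using add_mem hg hg'
      | smul c g _ hg => simpa [Pi.single_smul] using Submodule.smul_mem _ c hg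
    have : (WithLp.toLp 2 fun j => centerProj H Ξ (f j) : PowerRKHS m H)
        = ∑ j, WithLp.toLp 2 (Pi.single j (centerProj H Ξ (f j))) := by
      refine PiLp.ext fun i => ?_
      simp [Finset.sum_pi_single]
    rw [this]
    exact sum_mem fun j _ => hsingle j _ (Submodule.starProjection_apply_mem _ _)
  · intro g hg
    induction hg using Submodule.span_induction with
    | mem g hg =>
      obtain ⟨ξ, hξ, y, rfl⟩ := hg
      rw [PiLp.inner_apply]
      refine Finset.sum_eq_zero fun j _ => ?_
      rw [powerRKHS_kerFun]
      exact Submodule.starProjection_inner_eq_zero _ _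
        (Submodule.subset_span ⟨ξ, hξ, y j, rfl⟩)
    | zero => simp
    | add g g' _ _ hg hg' => rw [inner_add_right, hg, hg', add_zero]
    | smul c g _ hg => rw [inner_smul_right, hg, mul_zero]

/-- On scalars, `k(x,x) - k_N(x,x)` is `⟨k_x, k_x - Π_N k_x⟩`, and this is the squared norm because
the residual is orthogonal to `Π_N k_x`. -/
lemma norm_sub_centerProj_kerFun_le (Ξ : Finset X) (x : X) :
    ‖kerFun H x 1 - centerProj H Ξ (kerFun H x 1)‖ ≤ powerFunction H Ξ x := by
  refine Real.le_sqrt_of_sq_le ?_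
  set T := kernel H x x - centerKernel H Ξ x x with hT
  set u := kerFun H x 1 with hu
  have h1 : inner ℝ (1 : ℝ) (T 1) = ‖u - centerProj H Ξ u‖ ^ 2 := by
    rw [hT, sub_apply, kernel_apply, centerKernel]
    simp only [ContinuousLinearMap.comp_apply, inner_sub_right,
      ContinuousLinearMap.adjoint_inner_right]
    rw [← hu, ← inner_sub_right, ← real_inner_self_eq_norm_sq, inner_sub_left u,
      real_inner_comm (u - centerProj H Ξ u) (centerProj H Ξ u)]
    have := Submodule.starProjection_inner_eq_zero (K := centerSpace H Ξ) u _
      (Submodule.starProjection_apply_mem (centerSpace H Ξ) u)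
    rw [centerProj, this, sub_zero]
  rw [← h1]
  calc inner ℝ (1 : ℝ) (T 1) ≤ ‖(1 : ℝ)‖ * ‖T 1‖ := real_inner_le_norm _ _
    _ ≤ ‖T‖ := by simpa using T.le_opNorm 1

/-- Self-adjointness of `Π_N` moves `I - Π_N` from `g` to the kernel section; then Cauchy–Schwarz.
-/
lemma abs_sub_centerProj_apply_le (Ξ : Finset X) (x : X) (g : H) :
    |(g - centerProj H Ξ g : H) x| ≤ powerFunction H Ξ x * ‖g‖ := by
  have h1 : (g - centerProj H Ξ g : H) x
      = inner ℝ (kerFun H x 1 - centerProj H Ξ (kerFun H x 1)) g := by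
    have : (g - centerProj H Ξ g : H) x = inner ℝ (1 : ℝ) ((g - centerProj H Ξ g : H) x) := by
      simp
    rw [this, ← kerFun_inner, inner_sub_left, inner_sub_right]
    congr 1
    exact Submodule.inner_starProjection_left_eq_right _ _ _ |>.symm
  rw [h1]
  exact (abs_real_inner_le_norm _ _).trans
    (mul_le_mul_of_nonneg_right (norm_sub_centerProj_kerFun_le Ξ x) (norm_nonneg _))

lemma norm_evalAt_sub_centerProj_le (Ξ : Finset X) (x : X) (f : PowerRKHS m H) :
    ‖evalAt x (f - centerProj (PowerRKHS m H) Ξ f)‖ ≤ powerFunction H Ξ x * ‖f‖ := by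
  have hP : 0 ≤ powerFunction H Ξ x := Real.sqrt_nonneg _
  refine le_of_sq_le_sq ?_ (by positivity)
  rw [mul_pow, EuclideanSpace.norm_sq_eq, PiLp.norm_sq_eq_of_L2, Finset.mul_sum]
  refine Finset.sum_le_sum fun j _ => ?_
  rw [← mul_pow, evalAt_apply, centerProj_powerRKHS]
  exact pow_le_pow_left₀ (norm_nonneg _) (abs_sub_centerProj_apply_le Ξ x (f j)) 2

/-- Uniformly bounded evaluations make the supremum in the threshold finite and let `V` bound the
functional estimation error pointwise. -/
lemma norm_evalAt_le {kbar : ℝ} (hk : ∀ x : X, ‖kernel H x x‖ ≤ kbar ^ 2) (x : X)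
    (f : PowerRKHS m H) : ‖evalAt x f‖ ≤ |kbar| * ‖f‖ := by
  refine le_of_sq_le_sq ?_ (by positivity)
  rw [mul_pow, EuclideanSpace.norm_sq_eq, PiLp.norm_sq_eq_of_L2, Finset.mul_sum]
  refine Finset.sum_le_sum fun j _ => ?_
  rw [← mul_pow, evalAt_apply]
  refine pow_le_pow_left₀ (norm_nonneg _) ((norm_apply_le (f j) x).trans ?_) 2
  rw [mul_comm]
  gcongr
  exact (Real.sqrt_le_sqrt (hk x)).trans_eq (Real.sqrt_sq_eq_abs _)

end Projection

/-! ### Matrices acting on `𝒦^m` -/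

section MatAct

variable {H : Type*} [NormedAddCommGroup H] [InnerProductSpace ℝ H] {m : ℕ}

lemma matAct_apply (M : Matrix (Fin m) (Fin m) ℝ) (f : PowerRKHS m H) (i : Fin m) :
    matAct M f i = ∑ j, M i j • f j := rfl

lemma inner_matAct (M : Matrix (Fin m) (Fin m) ℝ) (f g : PowerRKHS m H) :
    inner ℝ f (matAct M g) = ∑ i, ∑ j, M i j * inner ℝ (f i) (g j) := by
  rw [PiLp.inner_apply]
  simp_rw [matAct_apply, inner_sum, real_inner_smul_right]

lemma matAct_inner (M : Matrix (Fin m) (Fin m) ℝ) (f g : PowerRKHS m H) :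
    inner ℝ (matAct M f) g = inner ℝ f (matAct M.transpose g) := by
  rw [real_inner_comm, inner_matAct, inner_matAct, Finset.sum_comm]
  simp_rw [Matrix.transpose_apply, real_inner_comm]

lemma matAct_matAct (M N : Matrix (Fin m) (Fin m) ℝ) (f : PowerRKHS m H) :
    matAct M (matAct N f) = matAct (M * N) f := by
  refine PiLp.ext fun i => ?_
  simp_rw [matAct_apply, Matrix.mul_apply, Finset.smul_sum, Finset.sum_smul, smul_smul]
  exact Finset.sum_comm

lemma sub_smul_one_matAct (M : Matrix (Fin m) (Fin m) ℝ) (c : ℝ) (f : PowerRKHS m H) :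
    matAct (M - c • 1) f = matAct M f - c • f := by
  refine PiLp.ext fun i => ?_
  simp [matAct_apply, sub_smul, Finset.sum_sub_distrib, Matrix.one_apply]

lemma Matrix.PosSemidef.inner_matAct_nonneg {M : Matrix (Fin m) (Fin m) ℝ} (hM : M.PosSemidef)
    (f : PowerRKHS m H) : 0 ≤ inner ℝ f (matAct M f) := by
  obtain ⟨L, rfl⟩ := hM.exists_eq_transpose_mul_self
  rw [← matAct_matAct, ← matAct_inner]
  exact real_inner_self_nonneg

lemma Matrix.PosDef.exists_le_inner_matAct (H : Type*) [NormedAddCommGroup H]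
    [InnerProductSpace ℝ H] {M : Matrix (Fin m) (Fin m) ℝ} (hM : M.PosDef) :
    ∃ c : ℝ, 0 < c ∧ ∀ f : PowerRKHS m H, c * ‖f‖ ^ 2 ≤ inner ℝ f (matAct M f) := by
  obtain ⟨c, hc, h⟩ := hM.exists_posSemidef_sub
  refine ⟨c, hc, fun f => ?_⟩
  have := h.inner_matAct_nonneg f
  rw [sub_smul_one_matAct, inner_sub_right, real_inner_smul_right,
    real_inner_self_eq_norm_sq] at this
  linarith

lemma hasDerivWithinAt_inner_matAct {M : Matrix (Fin m) (Fin m) ℝ} (hM : M.IsHermitian)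
    {g : ℝ → PowerRKHS m H} {g' : PowerRKHS m H} {s : Set ℝ} {t : ℝ}
    (hg : HasDerivWithinAt g g' s t) :
    HasDerivWithinAt (fun τ => inner ℝ (g τ) (matAct M (g τ)))
      (2 * inner ℝ g' (matAct M (g t))) s t := by
  have hcomp : ∀ i, HasDerivWithinAt (fun τ => g τ i) (g' i) s t := fun i =>
    (PiLp.proj (𝕜 := ℝ) 2 (fun _ : Fin m => H) i).hasFDerivAt.comp_hasDerivWithinAt t hg
  have hsymm : inner ℝ (g t) (matAct M g') = inner ℝ g' (matAct M (g t)) := by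
    rw [real_inner_comm, matAct_inner, ← Matrix.conjTranspose_eq_transpose_of_trivial, hM.eq]
  have hsum : HasDerivWithinAt (fun τ => ∑ i, ∑ j, M i j * inner ℝ (g τ i) (g τ j))
      (∑ i, ∑ j, M i j * (inner ℝ (g t i) (g' j) + inner ℝ (g' i) (g t j))) s t :=
    HasDerivWithinAt.fun_sum fun i _ => HasDerivWithinAt.fun_sum fun j _ =>
      ((hcomp i).inner ℝ (hcomp j)).const_mul _
  simp_rw [inner_matAct]
  convert hsum using 1
  simp_rw [mul_add, Finset.sum_add_distrib]
  rw [← inner_matAct, ← inner_matAct, hsymm, two_mul]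

variable {X : Type*} [RKHS ℝ H X ℝ]

lemma evalAt_matAct (M : Matrix (Fin m) (Fin m) ℝ) (x : X) (f : PowerRKHS m H) :
    evalAt x (matAct M f) = mv M (evalAt x f) := by
  ext i
  rw [evalAt_apply, matAct_apply, mv_apply]
  have : ∀ g : H, g x = (ContinuousLinearMap.proj x ∘L RKHS.coeCLM (H := H) ℝ : H →L[ℝ] ℝ) g :=
    fun _ => rfl
  rw [this, map_sum]
  simp_rw [map_smul, ← this]
  rfl

/-- Matrices mix the components while `Π_N` acts identically on each. This lets `Λ` pass through the
projection in the Lyapunov derivative. -/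
lemma centerProj_matAct [CompleteSpace H] (M : Matrix (Fin m) (Fin m) ℝ) (Ξ : Finset X)
    (f : PowerRKHS m H) :
    centerProj (PowerRKHS m H) Ξ (matAct M f) = matAct M (centerProj (PowerRKHS m H) Ξ f) := by
  rw [centerProj_powerRKHS, centerProj_powerRKHS]
  refine PiLp.ext fun i => ?_
  simp [matAct_apply]

end MatAct

/-! ### Weighted squares of gain errors -/

section WeightedSq

variable {a m : ℕ} {Γ : Matrix (Fin a) (Fin a) ℝ} {Λ : Matrix (Fin m) (Fin m) ℝ}

lemma weightedSq_nonneg (hΓ : Γ.PosDef) (hΛ : Λ.PosDef) (M : Matrix (Fin a) (Fin m) ℝ) :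
    0 ≤ weightedSq Γ Λ M := by
  refine Matrix.PosSemidef.trace_mul_nonneg ?_ hΛ.posSemidef
  simpa using hΓ.inv.posSemidef.conjTranspose_mul_mul_same M

lemma norm_sq_mv_transpose_le (M : Matrix (Fin a) (Fin m) ℝ) (v : EuclideanSpace ℝ (Fin a)) :
    ‖mv M.transpose v‖ ^ 2 ≤ (M.transpose * M).trace * ‖v‖ ^ 2 := by
  rw [EuclideanSpace.norm_sq_eq, EuclideanSpace.norm_sq_eq, Matrix.trace, Finset.sum_mul]
  refine Finset.sum_le_sum fun j _ => ?_
  rw [mv_apply, Real.norm_eq_abs, sq_abs, Matrix.diag_apply, Matrix.mul_apply]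
  refine (Finset.sum_mul_sq_le_sq_mul_sq _ _ _).trans_eq ?_
  simp [sq]

/-- Coercivity of the weighted square: from `Γ⁻¹ ≥ c₁` and `Λ ≥ c₂` one gets `tr(MᵀΓ⁻¹MΛ) ≥ c₁c₂
tr(MᵀM)`. It turns a bound on `V` into bounds on the gain errors. -/
lemma exists_norm_sq_mv_transpose_le (hΓ : Γ.PosDef) (hΛ : Λ.PosDef) :
    ∃ c : ℝ, 0 < c ∧ ∀ (M : Matrix (Fin a) (Fin m) ℝ) (v : EuclideanSpace ℝ (Fin a)),
      ‖mv M.transpose v‖ ^ 2 ≤ c * weightedSq Γ Λ M * ‖v‖ ^ 2 := by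
  obtain ⟨c₁, h₁, H₁⟩ := hΓ.inv.exists_posSemidef_sub
  obtain ⟨c₂, h₂, H₂⟩ := hΛ.exists_posSemidef_sub
  refine ⟨(c₁ * c₂)⁻¹, by positivity, fun M v => ?_⟩
  refine (norm_sq_mv_transpose_le M v).trans ?_
  gcongr
  rw [inv_mul_eq_div, le_div_iff₀' (by positivity)]
  have e₁ : 0 ≤ (M.transpose * (Γ⁻¹ - c₁ • 1) * M * Λ).trace := by
    refine Matrix.PosSemidef.trace_mul_nonneg ?_ hΛ.posSemidef
    simpa using H₁.conjTranspose_mul_mul_same M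
  have e₂ : 0 ≤ (M.transpose * M * (Λ - c₂ • 1)).trace := by
    refine Matrix.PosSemidef.trace_mul_nonneg ?_ H₂
    simpa using Matrix.posSemidef_conjTranspose_mul_self M
  simp only [Matrix.mul_sub, Matrix.sub_mul, Matrix.trace_sub, Matrix.mul_smul, Matrix.smul_mul,
    Matrix.trace_smul, Matrix.mul_one, smul_eq_mul] at e₁ e₂
  rw [weightedSq]
  nlinarith

lemma hasDerivWithinAt_weightedSq (hΓ : Γ.IsHermitian) (hΛ : Λ.IsHermitian)
    {M : ℝ → Matrix (Fin a) (Fin m) ℝ} {M' : Matrix (Fin a) (Fin m) ℝ} {s : Set ℝ} {t : ℝ}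
    (hM : ∀ i j, HasDerivWithinAt (fun τ => M τ i j) (M' i j) s t) :
    HasDerivWithinAt (fun τ => weightedSq Γ Λ (M τ))
      (2 * ((M t).transpose * Γ⁻¹ * M' * Λ).trace) s t := by
  have hΓ' : Γ⁻¹.transpose = Γ⁻¹ := by
    rw [← Matrix.conjTranspose_eq_transpose_of_trivial]; exact hΓ.inv.eq
  have hΛ' : Λ.transpose = Λ := by
    rw [← Matrix.conjTranspose_eq_transpose_of_trivial]; exact hΛ.eq
  have expand : ∀ N N' : Matrix (Fin a) (Fin m) ℝ, (N.transpose * Γ⁻¹ * N' * Λ).trace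
      = ∑ i, ∑ j, ∑ k, ∑ l, N l i * Γ⁻¹ l k * N' k j * Λ j i := by
    intro N N'
    simp [Matrix.trace, Matrix.mul_apply, Finset.sum_mul]
  have hsymm : (M'.transpose * Γ⁻¹ * M t * Λ).trace = ((M t).transpose * Γ⁻¹ * M' * Λ).trace := by
    rw [← Matrix.trace_transpose, Matrix.transpose_mul, Matrix.transpose_mul,
      Matrix.transpose_mul, hΓ', hΛ', Matrix.transpose_transpose, Matrix.trace_mul_comm]
    simp only [Matrix.mul_assoc]
  simp_rw [weightedSq, expand]
  have hsum : HasDerivWithinAt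
      (fun τ => ∑ i, ∑ j, ∑ k, ∑ l, M τ l i * Γ⁻¹ l k * M τ k j * Λ j i)
      (∑ i, ∑ j, ∑ k, ∑ l, (M' l i * Γ⁻¹ l k * M t k j + M t l i * Γ⁻¹ l k * M' k j) * Λ j i)
      s t :=
    HasDerivWithinAt.fun_sum fun i _ => HasDerivWithinAt.fun_sum fun j _ =>
      HasDerivWithinAt.fun_sum fun k _ => HasDerivWithinAt.fun_sum fun l _ =>
        ((((hM l i).mul_const _).mul (hM k j)).mul_const _)
  convert hsum using 1
  simp_rw [add_mul, Finset.sum_add_distrib]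
  rw [← expand, ← expand, hsymm, two_mul]

/-- `Γ⁻¹` cancels the adaptation gain, leaving the rank-one matrix `(Mᵀv)((PBΛ)ᵀe)ᵀ`, whose trace is
an inner product. -/
lemma trace_gain_law {n : ℕ} (hΓ : IsUnit Γ) (M : Matrix (Fin a) (Fin m) ℝ)
    (P : Matrix (Fin n) (Fin n) ℝ) (B : Matrix (Fin n) (Fin m) ℝ)
    (v : EuclideanSpace ℝ (Fin a)) (e : EuclideanSpace ℝ (Fin n)) :
    (M.transpose * Γ⁻¹ * (Γ * outer v e * P * B) * Λ).trace
      = inner ℝ (mv (P * B * Λ).transpose e) (mv M.transpose v) := by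
  have h1 : M.transpose * Γ⁻¹ * (Γ * outer v e * P * B) * Λ
      = Matrix.vecMulVec (M.transpose.mulVec v.ofLp) ((P * B * Λ).transpose.mulVec e.ofLp) := by
    calc _ = M.transpose * (Γ⁻¹ * Γ) * outer v e * (P * B * Λ) := by simp only [Matrix.mul_assoc]
      _ = _ := by
        rw [Matrix.nonsing_inv_mul _ ((Matrix.isUnit_iff_isUnit_det _).1 hΓ), Matrix.mul_one,
          outer, Matrix.mul_vecMulVec, Matrix.vecMulVec_mul, ← Matrix.mulVec_transpose (P * B * Λ)]
  rw [h1, Matrix.trace_vecMulVec, inner_eq_dotProduct, dotProduct_comm]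
  rfl

end WeightedSq

lemma hasDerivWithinAt_quadForm {n : ℕ} {P : Matrix (Fin n) (Fin n) ℝ} (hP : P.IsHermitian)
    {e : ℝ → EuclideanSpace ℝ (Fin n)} {e' : EuclideanSpace ℝ (Fin n)} {s : Set ℝ} {t : ℝ}
    (he : HasDerivWithinAt e e' s t) :
    HasDerivWithinAt (fun τ => quadForm P (e τ)) (2 * inner ℝ (mv P (e t)) e') s t := by
  have hlin : HasDerivWithinAt (fun τ => mv P (e τ)) (mv P e') s t :=
    (Matrix.toEuclideanLin P).toContinuousLinearMap.hasFDerivAt.comp_hasDerivWithinAt t he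
  have hP' : P.transpose = P := by
    rw [← Matrix.conjTranspose_eq_transpose_of_trivial]; exact hP.eq
  refine (he.inner ℝ hlin).congr_deriv ?_
  rw [inner_mv, hP', real_inner_comm (mv P (e t)), two_mul]

/-! ### Lyapunov functions with a deadzone -/

section Lyapunov

/-- Mean value inequality; the derivatives are one-sided only at time `0`, which is never interior.
-/
lemma sub_le_of_hasDerivWithinAt_le {f f' : ℝ → ℝ}
    (hf : ∀ t, 0 ≤ t → HasDerivWithinAt f (f' t) (Ici 0) t) {a b C : ℝ} (ha : 0 ≤ a) (hab : a ≤ b)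
    (hC : ∀ t ∈ Ioo a b, f' t ≤ C) : f b - f a ≤ C * (b - a) := by
  have hat : ∀ t ∈ Ioo a b, HasDerivAt f (f' t) t := fun t ht =>
    (hf t (ha.trans ht.1.le)).hasDerivAt (Ici_mem_nhds (ha.trans_lt ht.1))
  refine Convex.image_sub_le_mul_sub_of_deriv_le (convex_Icc a b) ?_ ?_ ?_ a
    (left_mem_Icc.2 hab) b (right_mem_Icc.2 hab) hab
  · exact fun t ht => (hf t (ha.trans ht.1)).continuousWithinAt.mono
      (Icc_subset_Ici_self.trans (Ici_subset_Ici.2 ha))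
  · rw [interior_Icc]
    exact fun t ht => (hat t ht).differentiableAt.differentiableWithinAt
  · rw [interior_Icc]
    intro t ht
    rw [(hat t ht).deriv]
    exact hC t ht

variable {D : ℝ} {σ : ℝ → ℝ}

lemma IsDeadzone.hasDerivWithinAt (hσ : IsDeadzone D σ) {y : ℝ} (hy : 0 ≤ y) :
    HasDerivWithinAt σ (derivWithin σ (Ici 0) y) (Ici 0) y :=
  (hσ.contDiff.differentiableOn one_ne_zero y hy).hasDerivWithinAt

lemma IsDeadzone.monotoneOn (hσ : IsDeadzone D σ) : MonotoneOn σ (Ici 0) := by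
  intro a ha b hb hab
  have := sub_le_of_hasDerivWithinAt_le (f := fun y => -σ y)
    (fun t ht => (hσ.hasDerivWithinAt ht).neg) ha hab (C := 0)
    fun t ht => neg_nonpos.2 (hσ.deriv_nonneg t (le_trans ha ht.1.le))
  linarith

/-- A Lyapunov function that decreases as long as `y ≤ M` and starts below its values at `y = M`
keeps `y` below `M`. -/
lemma lt_of_lyapunov {y V V' : ℝ → ℝ} {M : ℝ} (hσ : MonotoneOn σ (Ici 0))
    (hy0 : ∀ t, 0 ≤ t → 0 ≤ y t) (hM : 0 ≤ M) (hy : ContinuousOn y (Ici 0))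
    (hV : ∀ t, 0 ≤ t → HasDerivWithinAt V (V' t) (Ici 0) t) (hσV : ∀ t, 0 ≤ t → σ (y t) ≤ V t)
    (hV' : ∀ t, 0 ≤ t → y t < M → V' t ≤ 0) (h0 : V 0 < σ M) :
    ∀ t, 0 ≤ t → y t < M := by
  by_contra! hcon
  -- At the first time with `y ≥ M`, monotonicity of `σ` gives `V ≥ σ(y) ≥ σ(M) > V 0`, yet `V` has
  -- not increased before.
  set T : Set ℝ := Ici 0 ∩ y ⁻¹' Ici M with hT
  have hclosed : IsClosed T := hy.preimage_isClosed_of_isClosed isClosed_Ici isClosed_Ici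
  have hne : T.Nonempty := hcon
  have hbdd : BddBelow T := ⟨0, fun t ht => ht.1⟩
  obtain ⟨hT0, hTM⟩ := hclosed.csInf_mem hne hbdd
  have hlt : ∀ t ∈ Ioo 0 (sInf T), V' t ≤ 0 := fun t ht =>
    hV' t ht.1.le (not_le.1 fun h => absurd (csInf_le hbdd ⟨ht.1.le, h⟩) (not_le.2 ht.2))
  have := sub_le_of_hasDerivWithinAt_le hV le_rfl hT0 hlt
  have h1 := hσV _ hT0
  have h2 := hσ hM (hy0 _ hT0) hTM
  linarith

/-- If `V ≥ 0` decreases at rate `c σ'(y)` and `y` is Lipschitz, then `y` approaches the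
deadzone. -/
lemma IsDeadzone.eventually_le {y y' V V' : ℝ → ℝ} {M L c η : ℝ} (hσ : IsDeadzone D σ)
    (hyM : ∀ t, 0 ≤ t → y t ≤ M)
    (hy : ∀ t, 0 ≤ t → HasDerivWithinAt y (y' t) (Ici 0) t) (hL : 0 < L)
    (hyL : ∀ t, 0 ≤ t → -L ≤ y' t) (hc : 0 < c)
    (hV : ∀ t, 0 ≤ t → HasDerivWithinAt V (V' t) (Ici 0) t) (hV0 : ∀ t, 0 ≤ t → 0 ≤ V t)
    (hV' : ∀ t, 0 ≤ t → 0 ≤ y t → V' t ≤ -(c * derivWithin σ (Ici 0) (y t)))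
    (hy0 : ∀ t, 0 ≤ t → 0 ≤ y t) (hη : 0 < η) :
    ∀ᶠ t in atTop, y t ≤ D + η := by
  rcases lt_or_ge M (D + η / 2) with hMD | hMD
  · filter_upwards [eventually_ge_atTop 0] with t ht
    linarith [hyM t ht]
  have hD := hσ.size_pos
  have hcont : ContinuousOn (derivWithin σ (Ici 0)) (Icc (D + η / 2) M) :=
    hσ.deriv_lipschitz.continuousOn.mono fun z hz => by
      rw [mem_Ici]; linarith [hz.1]
  -- By compactness `σ'` has a positive minimum `μ` on `[D + η/2, M]`.
  obtain ⟨z, hz, hmin⟩ := isCompact_Icc.exists_isMinOn (nonempty_Icc.2 hMD) hcont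
  set μ := derivWithin σ (Ici 0) z with hμ
  have hμ0 : 0 < μ := hσ.deriv_pos z (by linarith [hz.1])
  -- Since `y' ≥ -L`, within time `τ` the value `y` can fall by at most `η/2`.
  set τ := η / (2 * L) with hτ
  have hτ0 : 0 < τ := by positivity
  have hne : (V '' Ici 0).Nonempty := ⟨V 0, 0, mem_Ici.2 le_rfl, rfl⟩
  have hbdd : BddBelow (V '' Ici 0) := ⟨0, by rintro _ ⟨t, ht, rfl⟩; exact hV0 t ht⟩
  -- `V t₀` is within `c μ τ` of the infimum of `V`; an excursion after `t₀` would make `V` drop by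
  -- at least that amount.
  obtain ⟨_, ⟨t₀, ht₀, rfl⟩, hlt⟩ := Real.lt_sInf_add_pos hne (show 0 < c * μ * τ by positivity)
  filter_upwards [eventually_ge_atTop t₀] with t ht
  have ht0 : 0 ≤ t := le_trans ht₀ ht
  by_contra! hcon
  have hstay : ∀ u ∈ Icc t (t + τ), D + η / 2 ≤ y u := by
    intro u hu
    have := sub_le_of_hasDerivWithinAt_le (f := fun v => -y v) (f' := fun v => -y' v)
      (fun v hv => (hy v hv).neg) ht0 hu.1 (C := L)
      fun v hv => by linarith [hyL v (ht0.trans hv.1.le)]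
    have h2 : L * (u - t) ≤ η / 2 := by
      calc L * (u - t) ≤ L * τ := by gcongr; linarith [hu.2]
        _ = η / 2 := by rw [hτ]; field_simp
    linarith
  have hdrop : V (t + τ) - V t ≤ -(c * μ) * (t + τ - t) := by
    refine sub_le_of_hasDerivWithinAt_le hV ht0 (by linarith) fun u hu => ?_
    have hu0 : 0 ≤ u := ht0.trans hu.1.le
    refine (hV' u hu0 (hy0 u hu0)).trans (neg_le_neg ?_)
    gcongr
    exact hmin ⟨hstay u (Ioo_subset_Icc_self hu), hyM u hu0⟩
  have hanti : V t - V t₀ ≤ 0 * (t - t₀) := by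
    refine sub_le_of_hasDerivWithinAt_le hV ht₀ ht fun u hu => ?_
    have hu0 : 0 ≤ u := le_trans ht₀ hu.1.le
    refine (hV' u hu0 (hy0 u hu0)).trans (neg_nonpos.2 ?_)
    exact mul_nonneg hc.le (hσ.deriv_nonneg _ (hy0 u hu0))
  have hinf : sInf (V '' Ici 0) ≤ V (t + τ) :=
    csInf_le hbdd ⟨t + τ, by rw [mem_Ici]; linarith, rfl⟩
  have : t + τ - t = τ := by ring
  rw [this] at hdrop
  linarith

end Lyapunov

/-! ### The closed loop -/

section ClosedLoop

variable {n m p : ℕ} {H : Type*} [NormedAddCommGroup H] [InnerProductSpace ℝ H]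

/-- The Lyapunov function of the closed loop. -/
noncomputable def MRACData.lyapunovFun (S : MRACData n m p) (f : PowerRKHS m H) (σ : ℝ → ℝ)
    (xr : ℝ → EuclideanSpace ℝ (Fin n)) (Z : LoopSignals n m p H) (t : ℝ) : ℝ :=
  σ (quadForm S.P (Z.x t - xr t)) + weightedSq S.Γx S.Λ (S.Kx - Z.Kx t)
    + weightedSq S.Γr S.Λ (S.Kr - Z.Kr t) + weightedSq S.ΓΘ S.Λ (S.Θ - Z.Θ t)
    + inner ℝ (f - Z.f t) (matAct (S.Γf⁻¹ * S.Λ) (f - Z.f t))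

variable {S : MRACData n m p} {Ξ : Finset (EuclideanSpace ℝ (Fin n))} {f : PowerRKHS m H}
  {σ : ℝ → ℝ} {r : ℝ → EuclideanSpace ℝ (Fin m)} {xr : ℝ → EuclideanSpace ℝ (Fin n)}
  {Z : LoopSignals n m p H}

/-- Commutation of `Γ_f` and `Λ` makes the product symmetric, so the functional term of `V` is a
genuine squared norm. -/
lemma MRACData.IsAdmissible.posDef_inv_mul (hS : S.IsAdmissible) : (S.Γf⁻¹ * S.Λ).PosDef :=
  hS.Γf_posDef.inv.mul_of_commute hS.Λ_posDef (by
    have hu := hS.Γf_posDef.isUnit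
    have h := hS.Γf_comm.eq
    have hd := (Matrix.isUnit_iff_isUnit_det _).1 hu
    calc S.Γf⁻¹ * S.Λ = S.Γf⁻¹ * (S.Λ * S.Γf) * S.Γf⁻¹ := by
          rw [Matrix.mul_assoc, Matrix.mul_assoc, Matrix.mul_nonsing_inv _ hd, Matrix.mul_one]
      _ = S.Λ * S.Γf⁻¹ := by
          rw [← h, ← Matrix.mul_assoc, Matrix.nonsing_inv_mul _ hd, Matrix.one_mul])

lemma MRACData.lyapunovFun_terms_le (hS : S.IsAdmissible) {D : ℝ} (hσ : IsDeadzone D σ) (t : ℝ) :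
    0 ≤ S.lyapunovFun f σ xr Z t ∧
    σ (quadForm S.P (Z.x t - xr t)) ≤ S.lyapunovFun f σ xr Z t ∧
    weightedSq S.Γx S.Λ (S.Kx - Z.Kx t) ≤ S.lyapunovFun f σ xr Z t ∧
    weightedSq S.Γr S.Λ (S.Kr - Z.Kr t) ≤ S.lyapunovFun f σ xr Z t ∧
    weightedSq S.ΓΘ S.Λ (S.Θ - Z.Θ t) ≤ S.lyapunovFun f σ xr Z t ∧
    inner ℝ (f - Z.f t) (matAct (S.Γf⁻¹ * S.Λ) (f - Z.f t)) ≤ S.lyapunovFun f σ xr Z t := by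
  have h0 := hσ.nonneg _ (hS.P_posDef.posSemidef.quadForm_nonneg (Z.x t - xr t))
  have h1 := weightedSq_nonneg hS.Γx_posDef hS.Λ_posDef (S.Kx - Z.Kx t)
  have h2 := weightedSq_nonneg hS.Γr_posDef hS.Λ_posDef (S.Kr - Z.Kr t)
  have h3 := weightedSq_nonneg hS.ΓΘ_posDef hS.Λ_posDef (S.Θ - Z.Θ t)
  have h4 := hS.posDef_inv_mul.posSemidef.inner_matAct_nonneg (f - Z.f t)
  rw [MRACData.lyapunovFun]
  refine ⟨?_, ?_, ?_, ?_, ?_, ?_⟩ <;> linarith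

variable [CompleteSpace H] [RKHS ℝ H (EuclideanSpace ℝ (Fin n)) ℝ]

/-- The input mismatch `-K̃_xᵀ x - K̃_rᵀ r + Θ̃ᵀ Φ(x) + f̃(x)` that drives the tracking error. -/
noncomputable def MRACData.mismatch (S : MRACData n m p) (f : PowerRKHS m H)
    (r : ℝ → EuclideanSpace ℝ (Fin m)) (Z : LoopSignals n m p H) (t : ℝ) :
    EuclideanSpace ℝ (Fin m) :=
  mv (S.Θ - Z.Θ t).transpose (S.Φ (Z.x t)) + evalAt (Z.x t) (f - Z.f t)
    - mv (S.Kx - Z.Kx t).transpose (Z.x t) - mv (S.Kr - Z.Kr t).transpose (r t)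

/-- The matching conditions absorb `A_ref - A` and `B_ref` into the input channel `BΛ`, leaving only
estimation errors. -/
lemma MRACData.hasDerivWithinAt_error (hS : S.IsAdmissible) (hxr : S.IsReference r xr)
    (hZ : S.IsClosedLoop Ξ f σ r xr Z) {t : ℝ} (ht : 0 ≤ t) :
    HasDerivWithinAt (fun τ => Z.x τ - xr τ)
      (mv S.Aref (Z.x t - xr t) + mv (S.B * S.Λ) (S.mismatch f r Z t)) (Ici 0) t := by
  refine ((hZ.state t ht).sub (hxr t ht)).congr_deriv ?_
  rw [MRACData.control, MRACData.mismatch, hS.match_B]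
  have hA : mv S.Aref (Z.x t - xr t) = mv S.A (Z.x t) +
      mv (S.B * S.Λ) (mv S.Kx.transpose (Z.x t)) - mv S.Aref (xr t) := by
    rw [mv_sub, mv_mv, ← add_mv, ← hS.match_A]
  rw [hA, ← mv_mv (S.B * S.Λ) S.Kr.transpose]
  simp only [Matrix.transpose_sub, sub_mv, mv_add, mv_sub, evalAt_sub]
  abel

/-- The Lyapunov equation turns `2⟨Pe, A_ref e⟩` into `-eᵀQe`. -/
lemma MRACData.hasDerivWithinAt_quadForm_error (hS : S.IsAdmissible) (hxr : S.IsReference r xr)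
    (hZ : S.IsClosedLoop Ξ f σ r xr Z) {t : ℝ} (ht : 0 ≤ t) :
    HasDerivWithinAt (fun τ => quadForm S.P (Z.x τ - xr τ))
      (-quadForm S.Q (Z.x t - xr t) + 2 * inner ℝ
        (mv (S.P * S.B * S.Λ).transpose (Z.x t - xr t)) (S.mismatch f r Z t)) (Ici 0) t := by
  refine (hasDerivWithinAt_quadForm hS.P_posDef.1
    (S.hasDerivWithinAt_error hS hxr hZ ht)).congr_deriv ?_
  set e := Z.x t - xr t
  have hP : S.P.transpose = S.P := by
    rw [← Matrix.conjTranspose_eq_transpose_of_trivial]; exact hS.P_posDef.1.eq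
  have h1 : 2 * inner ℝ (mv S.P e) (mv S.Aref e) = -quadForm S.Q e := by
    have hA : inner ℝ (mv S.P e) (mv S.Aref e) = inner ℝ e (mv (S.P * S.Aref) e) := by
      rw [← mv_mv, inner_mv S.P, hP]
    have hB : inner ℝ (mv S.P e) (mv S.Aref e) = inner ℝ e (mv (S.Aref.transpose * S.P) e) := by
      rw [← mv_mv, inner_mv S.Aref.transpose, Matrix.transpose_transpose, real_inner_comm]
    have hQ : -quadForm S.Q e = inner ℝ e (mv (S.Aref.transpose * S.P + S.P * S.Aref) e) := by
      rw [hS.lyapunov, quadForm, ← inner_neg_right]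
      congr 1
      ext i; simp [mv, Matrix.neg_mulVec]
    rw [hQ, add_mv, inner_add_right, ← hA, ← hB, two_mul]
  have h2 : inner ℝ (mv S.P e) (mv (S.B * S.Λ) (S.mismatch f r Z t))
      = inner ℝ (mv (S.P * S.B * S.Λ).transpose e) (S.mismatch f r Z t) := by
    rw [inner_mv, mv_mv, Matrix.mul_assoc, Matrix.transpose_mul S.P, hP]
  rw [inner_add_right, mul_add, h1, h2]

/-- With `c = ∓σ'(y)`, the sign in each learning law, this is the negative of the matching mismatch
term in the derivative of `σ(y)`. -/
lemma hasDerivWithinAt_weightedSq_sub {a : ℕ} {Γ : Matrix (Fin a) (Fin a) ℝ}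
    {Λ : Matrix (Fin m) (Fin m) ℝ} (hΓ : Γ.PosDef) (hΛ : Λ.PosDef)
    (K₀ : Matrix (Fin a) (Fin m) ℝ) {K : ℝ → Matrix (Fin a) (Fin m) ℝ} {c t : ℝ}
    {P : Matrix (Fin n) (Fin n) ℝ} {B : Matrix (Fin n) (Fin m) ℝ}
    {v : EuclideanSpace ℝ (Fin a)} {e : EuclideanSpace ℝ (Fin n)} {s : Set ℝ}
    (hK : ∀ i j, HasDerivWithinAt (fun τ => K τ i j) (c * (Γ * outer v e * P * B) i j) s t) :
    HasDerivWithinAt (fun τ => weightedSq Γ Λ (K₀ - K τ))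
      (-(2 * c * inner ℝ (mv (P * B * Λ).transpose e) (mv (K₀ - K t).transpose v))) s t := by
  have h := hasDerivWithinAt_weightedSq (M := fun τ => K₀ - K τ)
    (M' := (-c) • (Γ * outer v e * P * B)) hΓ.1 hΛ.1
    (fun i j => ((hK i j).const_sub (K₀ i j)).congr_deriv (by simp))
  refine h.congr_deriv ?_
  rw [Matrix.mul_smul, Matrix.smul_mul, Matrix.trace_smul, trace_gain_law hΓ.isUnit, smul_eq_mul]
  ring

/-- The adaptation cancels all the mismatch but the projection error of the uncertainty. -/
lemma MRACData.hasDerivWithinAt_lyapunovFun (hS : S.IsAdmissible) {D : ℝ} (hσ : IsDeadzone D σ)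
    (hxr : S.IsReference r xr) (hZ : S.IsClosedLoop Ξ f σ r xr Z) {t : ℝ} (ht : 0 ≤ t) :
    HasDerivWithinAt (S.lyapunovFun f σ xr Z)
      (derivWithin σ (Ici 0) (quadForm S.P (Z.x t - xr t)) *
        (-quadForm S.Q (Z.x t - xr t) + 2 * inner ℝ
          (mv (S.P * S.B * S.Λ).transpose (Z.x t - xr t))
          (evalAt (Z.x t) (f - centerProj (PowerRKHS m H) Ξ f)))) (Ici 0) t := by
  have hqn : ∀ τ, 0 ≤ quadForm S.P (Z.x τ - xr τ) := fun τ =>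
    hS.P_posDef.posSemidef.quadForm_nonneg _
  have hq := S.hasDerivWithinAt_quadForm_error hS hxr hZ ht
  have hσq := (hσ.hasDerivWithinAt (hqn t)).scomp t hq fun τ _ => hqn τ
  have hKx := hasDerivWithinAt_weightedSq_sub hS.Γx_posDef hS.Λ_posDef S.Kx (hZ.law_Kx t ht)
  have hKr := hasDerivWithinAt_weightedSq_sub hS.Γr_posDef hS.Λ_posDef S.Kr (hZ.law_Kr t ht)
  have hΘ := hasDerivWithinAt_weightedSq_sub hS.ΓΘ_posDef hS.Λ_posDef S.Θ (hZ.law_Θ t ht)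
  have hf := hasDerivWithinAt_inner_matAct hS.posDef_inv_mul.1 ((hZ.law_f t ht).const_sub f)
  refine ((((hσq.add hKx).add hKr).add hΘ).add hf).congr_deriv ?_
  have hmem := hZ.mem_f t ht
  set e := Z.x t - xr t
  set d := derivWithin σ (Ici 0) (quadForm S.P e)
  set z := mv (S.P * S.B * S.Λ).transpose e with hz
  have hT : ∀ {M : Matrix (Fin m) (Fin m) ℝ}, M.PosDef → M.transpose = M := fun hM => by
    rw [← Matrix.conjTranspose_eq_transpose_of_trivial]; exact hM.1.eq
  have hP : S.P.transpose = S.P := by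
    rw [← Matrix.conjTranspose_eq_transpose_of_trivial]; exact hS.P_posDef.1.eq
  have hproj : centerProj (PowerRKHS m H) Ξ (f - Z.f t)
      = centerProj (PowerRKHS m H) Ξ f - Z.f t := by
    rw [map_sub]
    congr 1
    exact Submodule.starProjection_eq_self_iff.2 hmem
  -- `Γ_f` cancels `Γ_f⁻¹`, self-adjointness moves `Π_N` to `f̃`, and the reproducing property turns
  -- the kernel section into evaluation at `x`.
  have hfval : inner ℝ (matAct S.Γf (centerProj (PowerRKHS m H) Ξ
        (kerFun (PowerRKHS m H) (Z.x t) (mv (S.B.transpose * S.P) e))))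
        (matAct (S.Γf⁻¹ * S.Λ) (f - Z.f t))
      = inner ℝ z (evalAt (Z.x t) (centerProj (PowerRKHS m H) Ξ (f - Z.f t))) := by
    have hd := (Matrix.isUnit_iff_isUnit_det _).1 hS.Γf_posDef.isUnit
    rw [matAct_inner, hT hS.Γf_posDef, matAct_matAct, ← Matrix.mul_assoc,
      Matrix.mul_nonsing_inv _ hd, Matrix.one_mul, centerProj,
      Submodule.inner_starProjection_left_eq_right, ← centerProj, centerProj_matAct,
      inner_kerFun_powerRKHS, evalAt_matAct, inner_mv, mv_mv, hT hS.Λ_posDef, hz,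
      Matrix.transpose_mul, Matrix.transpose_mul, hT hS.Λ_posDef, hP]
  -- As `f̂_N` is fixed by `Π_N`, it drops out: `f̃ - Π_N f̃ = f - Π_N f`.
  rw [inner_neg_left, real_inner_smul_left, hfval, hproj, MRACData.mismatch]
  simp only [smul_eq_mul, evalAt_sub, inner_add_right, inner_sub_right]
  ring

lemma exists_norm_mv_transpose_le {a : ℕ} {Γ : Matrix (Fin a) (Fin a) ℝ}
    {Λ : Matrix (Fin m) (Fin m) ℝ} (hΓ : Γ.PosDef) (hΛ : Λ.PosDef) (V b : ℝ) :
    ∃ c : ℝ, ∀ (M : Matrix (Fin a) (Fin m) ℝ) (v : EuclideanSpace ℝ (Fin a)),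
      weightedSq Γ Λ M ≤ V → ‖v‖ ≤ b → ‖mv M.transpose v‖ ≤ c := by
  obtain ⟨c, hc, h⟩ := exists_norm_sq_mv_transpose_le hΓ hΛ
  refine ⟨√(c * V * b ^ 2), fun M v hM hv => Real.le_sqrt_of_sq_le ((h M v).trans ?_)⟩
  have := (weightedSq_nonneg hΓ hΛ M).trans hM
  gcongr

/-- The mismatch is bounded as long as state, reference and Lyapunov function are. -/
lemma MRACData.exists_norm_mismatch_le (hS : S.IsAdmissible) {D kbar : ℝ} (hσ : IsDeadzone D σ)
    (hk : ∀ x : EuclideanSpace ℝ (Fin n), ‖RKHS.kernel H x x‖ ≤ kbar ^ 2)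
    (f : PowerRKHS m H) (r : ℝ → EuclideanSpace ℝ (Fin m)) (xr : ℝ → EuclideanSpace ℝ (Fin n))
    (Z : LoopSignals n m p H) (b rbar V : ℝ) :
    ∃ c : ℝ, ∀ t, ‖Z.x t‖ ≤ b → ‖r t‖ ≤ rbar → S.lyapunovFun f σ xr Z t ≤ V →
      ‖S.mismatch f r Z t‖ ≤ c := by
  obtain ⟨φ, hφ⟩ :=
    (isCompact_closedBall (0 : EuclideanSpace ℝ (Fin n)) b).exists_bound_of_continuousOn
      hS.Φ_continuous.continuousOn
  obtain ⟨c₁, h₁⟩ := exists_norm_mv_transpose_le hS.ΓΘ_posDef hS.Λ_posDef V φ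
  obtain ⟨c₂, h₂⟩ := exists_norm_mv_transpose_le hS.Γx_posDef hS.Λ_posDef V b
  obtain ⟨c₃, h₃⟩ := exists_norm_mv_transpose_le hS.Γr_posDef hS.Λ_posDef V rbar
  obtain ⟨c₄, hc₄, h₄⟩ := hS.posDef_inv_mul.exists_le_inner_matAct H
  refine ⟨c₁ + |kbar| * √(V / c₄) + c₂ + c₃, fun t hx hr hV => ?_⟩
  obtain ⟨-, -, e₂, e₃, e₁, e₄⟩ := S.lyapunovFun_terms_le (f := f) (xr := xr) (Z := Z) hS hσ t
  have hf : ‖f - Z.f t‖ ≤ √(V / c₄) := by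
    refine Real.le_sqrt_of_sq_le ?_
    rw [le_div_iff₀' hc₄]
    exact (h₄ _).trans (e₄.trans hV)
  have hev : ‖evalAt (Z.x t) (f - Z.f t)‖ ≤ |kbar| * √(V / c₄) :=
    (norm_evalAt_le hk _ _).trans (by gcongr)
  have b₁ := h₁ _ _ (e₁.trans hV) (hφ (Z.x t) (mem_closedBall_zero_iff.2 hx))
  have b₂ := h₂ _ _ (e₂.trans hV) hx
  have b₃ := h₃ _ _ (e₃.trans hV) hr
  rw [MRACData.mismatch]
  refine (norm_sub_le _ _).trans (add_le_add ((norm_sub_le _ _).trans (add_le_add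
    ((norm_add_le _ _).trans (add_le_add b₁ hev)) b₂)) b₃)

end ClosedLoop

/-! ### Decay outside the deadzone and the ultimate bound -/

section Performance

variable {n m p : ℕ} {H : Type*} [NormedAddCommGroup H] [InnerProductSpace ℝ H] [CompleteSpace H]
  [RKHS ℝ H (EuclideanSpace ℝ (Fin n)) ℝ]
  {S : MRACData n m p}

lemma MRACData.gain_nonneg [NeZero n] (hS : S.IsAdmissible) : 0 ≤ S.gain := by
  have := hS.Q_posDef.lamMin_pos
  have := opNorm_nonneg (S.P * S.B * S.Λ)
  rw [MRACData.gain]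
  positivity

lemma MRACData.performanceBound_eq (δ C ρ Rbar : ℝ) (s : ℕ)
    (Ξ : Finset (EuclideanSpace ℝ (Fin n))) :
    S.performanceBound δ C ρ Rbar s Ξ = ((1 + δ) * S.gain * C * ρ) *
      fillDistance (Ξ : Set (EuclideanSpace ℝ (Fin n))) (closedBall 0 Rbar) ^ s := rfl

lemma MRACData.threshold_le_performanceBound [NeZero n] (hS : S.IsAdmissible) {δ C ρ Rbar : ℝ}
    {s : ℕ} (hC : 0 ≤ C) (hδ : 0 ≤ δ) (hRbar : 0 ≤ Rbar)
    {Ξ : Finset (EuclideanSpace ℝ (Fin n))}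
    (hpow : ∀ x ∈ closedBall (0 : EuclideanSpace ℝ (Fin n)) Rbar, powerFunction H Ξ x ≤
      C * fillDistance (Ξ : Set (EuclideanSpace ℝ (Fin n))) (closedBall 0 Rbar) ^ s)
    {f : PowerRKHS m H} (hf : ‖f‖ ≤ ρ) :
    (1 + δ) * S.threshold Rbar Ξ f ≤ S.performanceBound δ C ρ Rbar s Ξ := by
  have hg := S.gain_nonneg hS
  have hh := fillDistance_nonneg (Ξ : Set (EuclideanSpace ℝ (Fin n))) (closedBall 0 Rbar)
  have : Nonempty (closedBall (0 : EuclideanSpace ℝ (Fin n)) Rbar) :=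
    ⟨⟨0, mem_closedBall_self hRbar⟩⟩
  have hsup : (⨆ ξ : closedBall (0 : EuclideanSpace ℝ (Fin n)) Rbar,
      ‖evalAt (ξ : EuclideanSpace ℝ (Fin n)) (f - centerProj (PowerRKHS m H) Ξ f)‖) ≤
      C * fillDistance (Ξ : Set (EuclideanSpace ℝ (Fin n))) (closedBall 0 Rbar) ^ s * ρ :=
    ciSup_le fun ξ => (norm_evalAt_sub_centerProj_le Ξ _ f).trans
      (mul_le_mul (hpow ξ ξ.2) hf (norm_nonneg _) (by positivity))
  rw [MRACData.threshold, S.performanceBound_eq]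
  calc _ ≤ (1 + δ) * (S.gain * (C * fillDistance (Ξ : Set (EuclideanSpace ℝ (Fin n)))
        (closedBall 0 Rbar) ^ s * ρ)) := by gcongr
    _ = _ := by ring

/-- Above the threshold, the Lyapunov derivative is negative outside the deadzone. -/
lemma MRACData.exists_rate [NeZero n] (hS : S.IsAdmissible) {Δ b : ℝ} (hb : 0 ≤ b)
    (hΔ : S.gain * b < Δ) :
    ∃ c : ℝ, 0 < c ∧ ∀ (e : EuclideanSpace ℝ (Fin n)) (E : EuclideanSpace ℝ (Fin m)), ‖E‖ ≤ b →
      lamMin S.P * Δ ^ 2 < quadForm S.P e →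
      -quadForm S.Q e + 2 * inner ℝ (mv (S.P * S.B * S.Λ).transpose e) E ≤ -c := by
  have hQ := hS.Q_posDef.lamMin_pos
  have hPm := hS.P_posDef.lamMin_pos
  have hPM := hS.P_posDef.lamMax_pos
  have hΔ0 : 0 < Δ := (mul_nonneg (S.gain_nonneg hS) hb).trans_lt hΔ
  set ν := √(lamMin S.P / lamMax S.P) with hν
  have hν0 : 0 < ν := Real.sqrt_pos.2 (by positivity)
  have hinv : √(lamMax S.P / lamMin S.P) * ν = 1 := by
    rw [hν, ← Real.sqrt_mul (by positivity), div_mul_div_comm, mul_comm,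
      div_self (by positivity), Real.sqrt_one]
  -- Multiplied by `λ_min(Q) ν`, the gap `Δ - gain · b` becomes the excess of the dissipation over
  -- the residual at `‖e‖ = νΔ`.
  have hslack : 0 < lamMin S.Q * (ν * Δ) - 2 * opNorm (S.P * S.B * S.Λ) * b := by
    have : 2 * opNorm (S.P * S.B * S.Λ) * b = lamMin S.Q * (ν * (S.gain * b)) := by
      rw [MRACData.gain]
      calc _ = 2 * opNorm (S.P * S.B * S.Λ) * b * (√(lamMax S.P / lamMin S.P) * ν) := by
            rw [hinv, mul_one]
        _ = _ := by field_simp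
    rw [this, ← mul_sub, ← mul_sub]
    have := sub_pos.2 hΔ
    positivity
  refine ⟨ν * Δ * (lamMin S.Q * (ν * Δ) - 2 * opNorm (S.P * S.B * S.Λ) * b), by positivity,
    fun e E hE he => ?_⟩
  have hen : ν * Δ ≤ ‖e‖ := by
    refine le_of_sq_le_sq ?_ (norm_nonneg e)
    rw [mul_pow, hν, Real.sq_sqrt (by positivity), div_mul_eq_mul_div, div_le_iff₀' hPM]
    exact he.le.trans (hS.P_posDef.1.quadForm_le_lamMax e)
  have h1 := hS.Q_posDef.1.lamMin_mul_norm_sq_le e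
  have h2 : inner ℝ (mv (S.P * S.B * S.Λ).transpose e) E
      ≤ opNorm (S.P * S.B * S.Λ) * ‖e‖ * b := by
    refine (real_inner_le_norm _ _).trans (mul_le_mul ?_ hE (norm_nonneg _) ?_)
    · rw [← opNorm_transpose]; exact norm_mv_le _ _
    · exact mul_nonneg (opNorm_nonneg _) (norm_nonneg _)
  have h3 : ν * Δ * (lamMin S.Q * (ν * Δ) - 2 * opNorm (S.P * S.B * S.Λ) * b)
      ≤ ‖e‖ * (lamMin S.Q * ‖e‖ - 2 * opNorm (S.P * S.B * S.Λ) * b) := by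
    gcongr
  nlinarith

lemma MRACData.UltimateBound.mono {Ξ : Finset (EuclideanSpace ℝ (Fin n))} {f : PowerRKHS m H}
    {xrbar R Δ b b' : ℝ} (h : S.UltimateBound Ξ f xrbar R Δ b) (hb : b ≤ b') :
    S.UltimateBound Ξ f xrbar R Δ b' :=
  fun σ hσ r xr Z Cx Cr CΘ Cf hr hxr href hZ hI =>
    (h σ hσ r xr Z Cx Cr CΘ Cf hr hxr href hZ hI).trans (ENNReal.ofReal_le_ofReal hb)

theorem MRACData.ultimateBound_of_threshold_lt [NeZero n] {kbar : ℝ}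
    (hk : ∀ x : EuclideanSpace ℝ (Fin n), ‖RKHS.kernel H x x‖ ≤ kbar ^ 2)
    (hS : S.IsAdmissible) {xrbar R Δ : ℝ} (hR : 0 < R)
    {Ξ : Finset (EuclideanSpace ℝ (Fin n))} {f : PowerRKHS m H}
    (hΔ : S.threshold (xrbar + R) Ξ f < Δ) : S.UltimateBound Ξ f xrbar R Δ Δ := by
  intro σ hσ r xr Z Cx Cr CΘ Cf ⟨rbar, hr⟩ hxr href hZ hI
  have hPm := hS.P_posDef.lamMin_pos
  set g := f - centerProj (PowerRKHS m H) Ξ f with hg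
  set b := ⨆ ξ : closedBall (0 : EuclideanSpace ℝ (Fin n)) (xrbar + R),
    ‖evalAt (ξ : EuclideanSpace ℝ (Fin n)) g‖ with hb
  have hb0 : 0 ≤ b := Real.iSup_nonneg fun _ => norm_nonneg _
  -- The bounded kernel gives the upper bound without which the real supremum would carry no
  -- information.
  have hgb : ∀ x : EuclideanSpace ℝ (Fin n), ‖x‖ ≤ xrbar + R → ‖evalAt x g‖ ≤ b := by
    intro x hx
    refine le_ciSup (f := fun ξ : closedBall (0 : EuclideanSpace ℝ (Fin n)) (xrbar + R) =>
      ‖evalAt (ξ : EuclideanSpace ℝ (Fin n)) g‖) ⟨|kbar| * ‖g‖, ?_⟩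
      ⟨x, mem_closedBall_zero_iff.2 hx⟩
    rintro _ ⟨ξ, rfl⟩
    exact norm_evalAt_le hk _ _
  have hΔ0 : 0 < Δ := (mul_nonneg (S.gain_nonneg hS) hb0).trans_lt hΔ
  obtain ⟨c, hc, hrate⟩ := S.exists_rate hS hb0 hΔ
  set y : ℝ → ℝ := fun t => quadForm S.P (Z.x t - xr t) with hy
  have hy0 : ∀ t, 0 ≤ y t := fun t => hS.P_posDef.posSemidef.quadForm_nonneg _
  set V := S.lyapunovFun f σ xr Z with hV
  have hVd := fun t (ht : 0 ≤ t) => S.hasDerivWithinAt_lyapunovFun hS hσ href hZ ht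
  have hyd := fun t (ht : 0 ≤ t) => S.hasDerivWithinAt_quadForm_error hS href hZ ht
  have hVterms := fun t => S.lyapunovFun_terms_le (f := f) (xr := xr) (Z := Z) hS hσ t
  have herr : ∀ t, y t < lamMin S.P * R ^ 2 → ‖Z.x t - xr t‖ < R := by
    intro t ht
    have h1 := (hS.P_posDef.1.lamMin_mul_norm_sq_le (Z.x t - xr t)).trans_lt ht
    exact lt_of_pow_lt_pow_left₀ 2 hR.le (lt_of_mul_lt_mul_left h1 hPm.le)
  have hstate : ∀ t, 0 ≤ t → y t < lamMin S.P * R ^ 2 → ‖Z.x t‖ ≤ xrbar + R := by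
    intro t ht hyt
    have := norm_add_le (Z.x t - xr t) (xr t)
    rw [sub_add_cancel] at this
    linarith [herr t hyt, hxr t ht]
  -- Inside the deadzone both sides vanish; outside, the state is in `Ω` and the rate `c` applies.
  have hdecay : ∀ t, 0 ≤ t → y t < lamMin S.P * R ^ 2 →
      derivWithin σ (Ici 0) (y t) * (-quadForm S.Q (Z.x t - xr t) + 2 * inner ℝ
        (mv (S.P * S.B * S.Λ).transpose (Z.x t - xr t)) (evalAt (Z.x t) g))
      ≤ -(c * derivWithin σ (Ici 0) (y t)) := by
    intro t ht hyt
    rcases le_or_gt (y t) (lamMin S.P * Δ ^ 2) with hD | hD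
    · rw [hσ.deriv_eq_zero _ ⟨hy0 t, hD⟩]; simp
    · have := hrate _ _ (hgb _ (hstate t ht hyt)) hD
      nlinarith [hσ.deriv_nonneg _ (hy0 t)]
  have hinit : V 0 < σ (lamMin S.P * R ^ 2) := by
    have h1 := hI.class_Kx
    have h2 := hI.class_Kr
    have h3 := hI.class_Θ
    have h4 := hI.class_f
    have h5 := hI.radius
    rw [hV, MRACData.lyapunovFun]
    linarith
  have hstay : ∀ t, 0 ≤ t → y t < lamMin S.P * R ^ 2 :=
    lt_of_lyapunov hσ.monotoneOn (fun t _ => hy0 t) (by positivity)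
      (fun t ht => (hyd t ht).continuousWithinAt) hVd (fun t _ => (hVterms t).2.1)
      (fun t ht hyt => (hdecay t ht hyt).trans
        (neg_nonpos.2 (mul_nonneg hc.le (hσ.deriv_nonneg _ (hy0 t))))) hinit
  have hVle : ∀ t, 0 ≤ t → V t ≤ V 0 := by
    intro t ht
    have := sub_le_of_hasDerivWithinAt_le hVd le_rfl ht (C := 0) fun u hu =>
      (hdecay u hu.1.le (hstay u hu.1.le)).trans
        (neg_nonpos.2 (mul_nonneg hc.le (hσ.deriv_nonneg _ (hy0 u))))
    linarith
  obtain ⟨w, hw⟩ := S.exists_norm_mismatch_le hS hσ hk f r xr Z (xrbar + R) rbar (V 0)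
  have hwt : ∀ t, 0 ≤ t → ‖S.mismatch f r Z t‖ ≤ w := fun t ht =>
    hw t (hstate t ht (hstay t ht)) (hr t ht) (hVle t ht)
  have hw0 : 0 ≤ w := (norm_nonneg _).trans (hwt 0 le_rfl)
  have hQM := hS.Q_posDef.lamMax_pos
  have hop := opNorm_nonneg (S.P * S.B * S.Λ)
  have hlip : ∀ t, 0 ≤ t → -(lamMax S.Q * R ^ 2 + 2 * (opNorm (S.P * S.B * S.Λ) * R * w)) ≤
      -quadForm S.Q (Z.x t - xr t) + 2 * inner ℝ
        (mv (S.P * S.B * S.Λ).transpose (Z.x t - xr t)) (S.mismatch f r Z t) := by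
    intro t ht
    have he := (herr t (hstay t ht)).le
    have h1 : quadForm S.Q (Z.x t - xr t) ≤ lamMax S.Q * R ^ 2 :=
      (hS.Q_posDef.1.quadForm_le_lamMax _).trans (by gcongr)
    have h2 : |inner ℝ (mv (S.P * S.B * S.Λ).transpose (Z.x t - xr t)) (S.mismatch f r Z t)|
        ≤ opNorm (S.P * S.B * S.Λ) * R * w := by
      refine (abs_real_inner_le_norm _ _).trans
        (mul_le_mul ?_ (hwt t ht) (norm_nonneg _) (by positivity))
      refine (norm_mv_le _ _).trans ?_
      rw [opNorm_transpose]
      gcongr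
    linarith [neg_abs_le
      (inner ℝ (mv (S.P * S.B * S.Λ).transpose (Z.x t - xr t)) (S.mismatch f r Z t))]
  have hlim : ∀ η : ℝ, 0 < η → ∀ᶠ t in atTop, y t ≤ lamMin S.P * Δ ^ 2 + η := fun η hη =>
    hσ.eventually_le (fun t ht => (hstay t ht).le) hyd (by positivity) hlip hc hVd
      (fun t _ => (hVterms t).1) (fun t ht _ => hdecay t ht (hstay t ht)) (fun t _ => hy0 t) hη
  refine ENNReal.le_of_forall_pos_le_add fun ε hε _ => ?_
  have hε' : (0 : ℝ) < ε := hε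
  refine limsup_le_of_le (h := ?_)
  -- This `η` gives `D + η = λ_min(P)(Δ + ε)²`.
  filter_upwards [hlim (lamMin S.P * ((Δ + ε) ^ 2 - Δ ^ 2)) (mul_pos hPm (by nlinarith))] with t ht
  have h1 := (hS.P_posDef.1.lamMin_mul_norm_sq_le (Z.x t - xr t)).trans ht
  have h2 : ‖Z.x t - xr t‖ ≤ Δ + ε := by
    refine le_of_sq_le_sq (le_of_mul_le_mul_left (h1.trans_eq ?_) hPm) (by positivity)
    ring
  rw [← ofReal_norm, ← ENNReal.ofReal_coe_nnreal,
    ← ENNReal.ofReal_add hΔ0.le hε'.le]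
  exact ENNReal.ofReal_le_ofReal h2

end Performance

/-! ### Tracking bound and number of centers combined -/

theorem mainTheorem5 {n m p : ℕ} (hn : 1 ≤ n)
    {H : Type*} [NormedAddCommGroup H] [InnerProductSpace ℝ H] [CompleteSpace H]
    [RKHS ℝ H (EuclideanSpace ℝ (Fin n)) ℝ]
    (kbar : ℝ) (hk : ∀ x : EuclideanSpace ℝ (Fin n), ‖RKHS.kernel H x x‖ ≤ kbar ^ 2)
    (S : MRACData n m p) (hS : S.IsAdmissible)
    (xrbar R : ℝ) (hxrbar : 0 ≤ xrbar) (hR : 0 < R)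
    (s : ℕ) (hs : 1 ≤ s) (C ρ δ q : ℝ) (hC : 0 < C) (hρ : 0 < ρ) (hδ : 0 < δ) (hq : 1 ≤ q)
    (Ξ : Finset (EuclideanSpace ℝ (Fin n))) (hΞ : Ξ.Nonempty)
    (hΞΩ : (Ξ : Set (EuclideanSpace ℝ (Fin n))) ⊆ closedBall 0 (xrbar + R))
    (hqu : IsQuasiuniform q (Ξ : Set (EuclideanSpace ℝ (Fin n))) (closedBall 0 (xrbar + R)))
    (hpow : ∀ x ∈ closedBall (0 : EuclideanSpace ℝ (Fin n)) (xrbar + R),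
      powerFunction H Ξ x ≤
        C * fillDistance (Ξ : Set (EuclideanSpace ℝ (Fin n))) (closedBall 0 (xrbar + R)) ^ s) :
    -- the deadzone threshold of every uncertainty in the class obeys the performance bound
    (∀ f : PowerRKHS m H, ‖f‖ ≤ ρ →
      (1 + δ) * S.threshold (xrbar + R) Ξ f ≤ S.performanceBound δ C ρ (xrbar + R) s Ξ) ∧
    -- every deadzone above the threshold bounds the ultimate tracking error
    (∀ (f : PowerRKHS m H) (Δ : ℝ), S.threshold (xrbar + R) Ξ f < Δ →
      S.UltimateBound Ξ f xrbar R Δ Δ) ∧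
    -- a performance bound of at most `ε` guarantees the target error `ε`, and takes at least of
    -- the order of `ε ^ (-n/s)` centers
    (∀ ε : ℝ, 0 < ε → S.performanceBound δ C ρ (xrbar + R) s Ξ ≤ ε →
      (∀ (f : PowerRKHS m H) (Δ : ℝ), ‖f‖ ≤ ρ → S.threshold (xrbar + R) Ξ f < Δ →
        Δ ≤ S.performanceBound δ C ρ (xrbar + R) s Ξ → S.UltimateBound Ξ f xrbar R Δ ε) ∧
      (xrbar + R) ^ n * ((1 + δ) * S.gain * C * ρ) ^ ((n : ℝ) / s) * (1 / ε ^ ((n : ℝ) / s))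
        ≤ (Ξ.card : ℝ)) ∧
    -- for quasiuniform centers this order is exact
    (∀ ε : ℝ, 0 < ε → ε ≤ S.performanceBound δ C ρ (xrbar + R) s Ξ →
      (Ξ.card : ℝ) ≤ (2 * q * (xrbar + R)) ^ n * ((1 + δ) * S.gain * C * ρ) ^ ((n : ℝ) / s) *
        (1 / ε ^ ((n : ℝ) / s))) := by
  -- Positive dimension makes the spectra of `P` and `Q` nonempty, so their extreme eigenvalues are
  -- positive.
  have : NeZero n := ⟨by omega⟩
  have hRbar : 0 < xrbar + R := by positivity
  have hg := S.gain_nonneg hS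
  have hh := fillDistance_nonneg (Ξ : Set (EuclideanSpace ℝ (Fin n))) (closedBall 0 (xrbar + R))
  have hC' : 0 ≤ (1 + δ) * S.gain * C * ρ := by positivity
  refine ⟨fun f hf => S.threshold_le_performanceBound hS hC.le hδ.le hRbar.le hpow hf,
    fun f Δ hΔ => S.ultimateBound_of_threshold_lt hk hS hR hΔ, fun ε hε hle =>
    ⟨fun f Δ _ hΔ hΔ' => (S.ultimateBound_of_threshold_lt hk hS hR hΔ).mono (hΔ'.trans hle), ?_⟩,
    fun ε hε hle => ?_⟩
  · have h1 := rpow_div_le_of_mul_pow_le (n := n) hs hC' hh hε hle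
    have h2 := pow_le_card_mul_fillDistance_pow hRbar.le hΞ
    rw [mul_assoc]
    -- `E = (C_*/ε)^{n/s}`; a performance bound at most `ε` means `h ^ n * E ≤ 1`, which is inserted
    -- into the covering bound.
    set E := ((1 + δ) * S.gain * C * ρ) ^ ((n : ℝ) / s) * (1 / ε ^ ((n : ℝ) / s))
    have hE : 0 ≤ E := by positivity
    set h := fillDistance (Ξ : Set (EuclideanSpace ℝ (Fin n))) (closedBall 0 (xrbar + R))
    calc (xrbar + R) ^ n * E ≤ (Ξ.card * h ^ n) * E := by gcongr
      _ = Ξ.card * (h ^ n * E) := by ring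
      _ ≤ Ξ.card * 1 := by gcongr
      _ = Ξ.card := mul_one _
  · have h1 := one_le_rpow_div_of_le_mul_pow (n := n) hs hC' hh hε hle
    have h2 := card_mul_fillDistance_pow_le hq hRbar hΞ hΞΩ hqu
    rw [mul_assoc ((2 * q * (xrbar + R)) ^ n)]
    -- Now `h ^ n * E ≥ 1`, to be inserted into the packing bound.
    set E := ((1 + δ) * S.gain * C * ρ) ^ ((n : ℝ) / s) * (1 / ε ^ ((n : ℝ) / s))
    have hE : 0 ≤ E := by positivity
    set h := fillDistance (Ξ : Set (EuclideanSpace ℝ (Fin n))) (closedBall 0 (xrbar + R))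
    calc (Ξ.card : ℝ) = Ξ.card * 1 := (mul_one _).symm
      _ ≤ Ξ.card * (h ^ n * E) := by gcongr
      _ = (Ξ.card * h ^ n) * E := by ring
      _ ≤ _ := by gcongr
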